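/- Let $n\ge 1$ and consider complex-valued functions on $\mathbb R^n$. For $1\le p<\infty$, $1\le q\le\infty$ or $p=q=\infty$, let $L^{p,q}$ be the Lorentz space of measurable functions $f$ with finite quasi-norm $\|f\|_{L^{p,q}}=\big(p\int_0^\infty[\alpha\,\mu_f(\alpha)^{1/p}]^q\frac{d\alpha}{\alpha}\big)^{1/q}$ if $p,q<\infty$, $\ \sup_{\alpha>0}\alpha\,\mu_f(\alpha)^{1/p}$ if $p<\infty=q$, $\ \inf\{\alpha>0:\mu_f(\alpha)=0\}$ if $p=q=\infty$, where $\mu_f(\alpha)=|\{x:|f(x)|>\alpha\}|$; put $L^{\infty,q}=\{0\}$ for $1\le q<\infty$. Let $\mathscr S_0$ be the space of Schwartz functions $\psi$ with $D^\alpha\hat\psi(0)=0$ for all multi-indices $\alpha$, and let $\mathscr S_0'$ be its dual. A function $f$ in a Lorentz space is identified with the functional $\psi\mapsto\int f\psi$ in $\mathscr S_0'$. Fix a sequence $\varphi=\{\varphi_j\}_{j\in\mathbb Z}$ in $C_c^\infty(\mathbb R^n)$ with $\operatorname{supp}\varphi_j\subset\{2^{j-1}\le|\xi|\le2^{j+1}\}$,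 $\sup_{j,\xi}2^{j|\alpha|}|D^\alpha\varphi_j(\xi)|<\infty$ for every multi-index $\alpha$, and $\sum_{j}\varphi_j(\xi)=1$ for $\xi\neq0$; put $\Delta_ju=(\varphi_j\hat u)^\vee=\varphi_j^\vee*u$ for $u\in\mathscr S_0'$. For $s\in\mathbb R$ and $1\le p\le\infty$, let $\dot B^{s,\infty}_{p,\infty}$ be the space of all $u\in\mathscr S_0'$ with $\|u\|_{\dot B^{s,\infty}_{p,\infty}}=\sup_{j\in\mathbb Z}2^{js}\|\Delta_ju\|_{L^{p,\infty}}<\infty$. **Theorem.** There are constants $c_{p_1}(f)\in\mathbb C$, depending only on $p_1$ and $f$, with $c_{p_1}(f)=0$ whenever $p_1<\infty$, such that the following holds. Let $s>0$, $1<p\le\infty$, $1\le p_1,p_2\le\infty$ and $0<\theta<1$ satisfy $$\frac1p=\frac{1-\theta}{p_1}+\theta\Big(\frac1{p_2}-\frac sn\Big)\qquad\text{and}\qquad \frac1{p_1}\neq\frac1{p_2}-\frac sn .$$ Let $q=1$ if $p<\infty$ and $q=\infty$ if $p=\infty$; let $q_1=\infty$ if $p_1>1$ and $q_1=1$ if $p_1=1$.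 Then there is a constant $C<\infty$, depending only on $n,s,p,p_1,p_2,\theta$ and $\varphi$, such that for every $f\in L^{p_1,q_1}\cap\dot B^{s,\infty}_{p_2,\infty}$, $$\|f-c_{p_1}(f)\|_{L^{p,q}}\le C\,\|f\|_{L^{p_1,q_1}}^{1-\theta}\,\|f\|_{\dot B^{s,\infty}_{p_2,\infty}}^{\theta}.$$ -/

import Mathlib

open MeasureTheory FourierTransform Set
open scoped ENNReal NNReal SchwartzMap

namespace LorentzGN

/-- The Euclidean space `ℝⁿ`. -/
abbrev Rn (n : ℕ) : Type := EuclideanSpace ℝ (Fin n)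

section Lorentz

variable {n : ℕ}

/-- The distribution function `μ_f(α) = |{x : |f x| > α}|`. -/
noncomputable def distrib (f : Rn n → ℂ) (α : ℝ) : ℝ≥0∞ :=
  volume {x : Rn n | α < ‖f x‖}

open Classical in
/-- The Lorentz quasi-norm `‖f‖_{L^{p,q}}` with values in `[0, ∞]`.
For `p = ∞` and `q < ∞` the space is `{0}`, i.e. the value is `0` if `f = 0` a.e. and `∞` otherwise. -/
noncomputable def lorentzNorm (f : Rn n → ℂ) (p q : ℝ≥0∞) : ℝ≥0∞ :=
  if p = ∞ then
    if q = ∞ then ⨅ (α : ℝ≥0) (_ : 0 < α) (_ : distrib f α = 0), (α : ℝ≥0∞)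
    else if f =ᵐ[volume] 0 then 0 else ∞
  else
    if q = ∞ then ⨆ (α : ℝ) (_ : 0 < α), ENNReal.ofReal α * distrib f α ^ (1 / p.toReal)
    else (p * ∫⁻ α in Ioi (0 : ℝ),
      (ENNReal.ofReal α * distrib f α ^ (1 / p.toReal)) ^ q.toReal / ENNReal.ofReal α)
        ^ (1 / q.toReal)

/-- `f ∈ L^{p,q}(ℝⁿ)`. -/
def MemLorentz (f : Rn n → ℂ) (p q : ℝ≥0∞) : Prop :=
  AEStronglyMeasurable f volume ∧ lorentzNorm f p q < ∞

end Lorentz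

section Distributions

/-- The space `𝓢₀` of Schwartz functions all of whose derivatives of the Fourier transform vanish
at the origin, with the topology induced from `𝓢`. -/
noncomputable def S0 (n : ℕ) : Submodule ℂ 𝓢(Rn n, ℂ) where
  carrier := {ψ | ∀ k : ℕ, iteratedFDeriv ℝ k (𝓕 ψ : 𝓢(Rn n, ℂ)) 0 = 0}
  zero_mem' := by
    intro k
    rw [FourierTransform.fourier_zero]
    exact congrFun (iteratedFDeriv_fun_zero (𝕜 := ℝ) (n := k)) 0
  add_mem' := by
    intro a b ha hb k
    have h : ⇑(𝓕 (a + b) : 𝓢(Rn n, ℂ)) =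
        ⇑(𝓕 a : 𝓢(Rn n, ℂ)) + ⇑(𝓕 b : 𝓢(Rn n, ℂ)) := by
      rw [FourierTransform.fourier_add]
      rfl
    rw [h, iteratedFDeriv_add_apply
      ((𝓕 a : 𝓢(Rn n, ℂ)).smooth k).contDiffAt ((𝓕 b : 𝓢(Rn n, ℂ)).smooth k).contDiffAt,
      ha k, hb k, add_zero]
  smul_mem' := by
    intro c a ha k
    have h : ⇑(𝓕 (c • a) : 𝓢(Rn n, ℂ)) = c • ⇑(𝓕 a : 𝓢(Rn n, ℂ)) := by
      rw [FourierTransform.fourier_smul]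
      rfl
    rw [h, iteratedFDeriv_const_smul_apply
      ((𝓕 a : 𝓢(Rn n, ℂ)).smooth k).contDiffAt, ha k, smul_zero]

/-- The topological dual `𝓢₀'` of `𝓢₀` (tempered distributions modulo polynomials). -/
abbrev S0Dual (n : ℕ) : Type := S0 n →L[ℂ] ℂ

variable {n : ℕ}

/-- The distribution `u ∈ 𝓢₀'` is the one given by the function `f`: `⟨u, ψ⟩ = ∫ f ψ`. -/
def IsGivenBy (u : S0Dual n) (f : Rn n → ℂ) : Prop :=
  ∀ ψ : S0 n, Integrable (fun y => f y * (ψ : 𝓢(Rn n, ℂ)) y) ∧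
    u ψ = ∫ y, f y * (ψ : 𝓢(Rn n, ℂ)) y

/-- The Schwartz function `y ↦ φ^∨(x - y)`. -/
noncomputable def convKernel (φ : 𝓢(Rn n, ℂ)) (x : Rn n) : 𝓢(Rn n, ℂ) :=
  SchwartzMap.compSubConstCLM ℂ x
    (SchwartzMap.compCLMOfContinuousLinearEquiv ℂ
      ((LinearIsometryEquiv.neg ℝ (E := Rn n)).toContinuousLinearEquiv)
      (𝓕⁻ φ : 𝓢(Rn n, ℂ)))

lemma convKernel_apply (φ : 𝓢(Rn n, ℂ)) (x y : Rn n) :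
    convKernel φ x y = (𝓕⁻ φ : 𝓢(Rn n, ℂ)) (x - y) := by
  simp [convKernel]

lemma fourier_convKernel (φ : 𝓢(Rn n, ℂ)) (x ξ : Rn n) :
    ∃ c : ℂ, (𝓕 (convKernel φ x) : 𝓢(Rn n, ℂ)) ξ = c * φ (-ξ) := by
  have h1 : (convKernel φ x : Rn n → ℂ) =
      (((𝓕⁻ φ : 𝓢(Rn n, ℂ)) : Rn n → ℂ) ∘ (LinearIsometryEquiv.neg ℝ (E := Rn n))) ∘
        fun v => v + -x := by
    ext y
    rw [convKernel_apply]
    simp [sub_eq_add_neg]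
  have h2 := congrFun (VectorFourier.fourierIntegral_comp_add_right Real.fourierChar
    (volume : Measure (Rn n)) (innerₗ (Rn n))
    (((𝓕⁻ φ : 𝓢(Rn n, ℂ)) : Rn n → ℂ) ∘ (LinearIsometryEquiv.neg ℝ (E := Rn n))) (-x)) ξ
  rw [← h1] at h2
  have h3 : 𝓕 (((𝓕⁻ φ : 𝓢(Rn n, ℂ)) : Rn n → ℂ) ∘ (LinearIsometryEquiv.neg ℝ (E := Rn n))) ξ
      = φ (-ξ) := by
    have h4 := Real.fourier_comp_linearIsometry
      (LinearIsometryEquiv.neg ℝ (E := Rn n)) ((𝓕⁻ φ : 𝓢(Rn n, ℂ)) : Rn n → ℂ) ξ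
    rw [h4, ← SchwartzMap.fourier_coe, FourierTransform.fourier_fourierInv_eq]
    rfl
  refine ⟨(Real.fourierChar (innerₗ (Rn n) (-x) ξ) : ℂ), ?_⟩
  rw [← h3]
  exact h2

lemma convKernel_mem (φ : 𝓢(Rn n, ℂ)) (hφ : (0 : Rn n) ∉ tsupport φ) (x : Rn n) :
    convKernel φ x ∈ S0 n := by
  intro k
  have h1 : ∀ᶠ ξ in nhds (0 : Rn n), φ (-ξ) = 0 := by
    have h2 : ∀ᶠ ξ in nhds (-(0 : Rn n)), φ ξ = 0 := by
      rw [neg_zero]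
      exact notMem_tsupport_iff_eventuallyEq.mp hφ
    exact (continuous_neg.tendsto (0 : Rn n)).eventually h2
  have h3 : (𝓕 (convKernel φ x) : 𝓢(Rn n, ℂ)) =ᶠ[nhds (0 : Rn n)] (fun _ => (0 : ℂ)) := by
    filter_upwards [h1] with ξ hξ
    obtain ⟨c, hc⟩ := fourier_convKernel φ x ξ
    rw [hc, hξ, mul_zero]
  rw [(h3.iteratedFDeriv ℝ k).eq_of_nhds]
  exact congrFun (iteratedFDeriv_fun_zero (𝕜 := ℝ) (n := k)) 0

/-- For `φ ∈ C_c^∞` vanishing near the origin and `u ∈ 𝓢₀'`, the smooth function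
`(φ û)^∨ = φ^∨ ∗ u`, that is, `x ↦ ⟨u, φ^∨(x - ·)⟩`. -/
noncomputable def block (φ : 𝓢(Rn n, ℂ)) (hφ : (0 : Rn n) ∉ tsupport φ) (u : S0Dual n) :
    Rn n → ℂ :=
  fun x => u ⟨convKernel φ x, convKernel_mem φ hφ x⟩

end Distributions

section Besov

/-- A homogeneous Littlewood-Paley family `φ = {φ_j}_{j ∈ ℤ}` in `C_c^∞(ℝⁿ)`. (A Schwartz function
supported in a bounded annulus is the same thing as a `C_c^∞` function supported there.) -/
structure LPFamily (n : ℕ) where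
  φ : ℤ → 𝓢(Rn n, ℂ)
  supp : ∀ j, tsupport (φ j) ⊆ {ξ | (2 : ℝ) ^ (j - 1) ≤ ‖ξ‖ ∧ ‖ξ‖ ≤ (2 : ℝ) ^ (j + 1)}
  bound : ∀ k : ℕ, ∃ C : ℝ, ∀ (j : ℤ) (ξ : Rn n),
    (2 : ℝ) ^ (j * (k : ℤ)) * ‖iteratedFDeriv ℝ k (φ j) ξ‖ ≤ C
  sum_eq_one : ∀ ξ : Rn n, ξ ≠ 0 → HasSum (fun j => φ j ξ) 1

variable {n : ℕ}

lemma LPFamily.zero_notMem (Φ : LPFamily n) (j : ℤ) : (0 : Rn n) ∉ tsupport (Φ.φ j) := by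
  intro h
  have h1 := (Φ.supp j h).1
  rw [norm_zero] at h1
  exact absurd h1 (not_le.mpr (by positivity))

/-- The Littlewood-Paley operators `Δ_j^φ u = (φ_j û)^∨` on `𝓢₀'`. -/
noncomputable def LPFamily.Δ (Φ : LPFamily n) (j : ℤ) (u : S0Dual n) : Rn n → ℂ :=
  block (Φ.φ j) (Φ.zero_notMem j) u

open Classical in
/-- The norm of `ℓ^r(ℤ)`, for sequences with values in `[0, ∞]`. -/
noncomputable def seqNorm (a : ℤ → ℝ≥0∞) (r : ℝ≥0∞) : ℝ≥0∞ :=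
  if r = ∞ then ⨆ j, a j else (∑' j, a j ^ r.toReal) ^ (1 / r.toReal)

/-- The quasi-norm `‖{2^{js} Δ_j^φ u}‖_{ℓ^r(L^{p,q})}` of the homogeneous Besov-Lorentz space
`Ḃ^{s,r}_{p,q}`. -/
noncomputable def besovNorm (Φ : LPFamily n) (u : S0Dual n) (s : ℝ) (p q r : ℝ≥0∞) : ℝ≥0∞ :=
  seqNorm (fun j => ENNReal.ofReal ((2 : ℝ) ^ ((j : ℝ) * s)) * lorentzNorm (Φ.Δ j u) p q) r

/-- `u ∈ Ḃ^{s,r}_{p,q}`. -/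
def MemBesov (Φ : LPFamily n) (u : S0Dual n) (s : ℝ) (p q r : ℝ≥0∞) : Prop :=
  besovNorm Φ u s p q r < ∞

end Besov

end LorentzGN

/-! Write σ = 1/p₂ - s/n, let A and B bound the Lorentz and Besov norms, and let L_J f be the part
of f at frequencies up to about 2^J. Membership in L^{p₁,q₁} bounds all averages of |f| at scale
2^(-J) (`exists_avgBound`), so |L_J f| ≲ A 2^(Jn/p₁). The Besov norm bounds the pieces Δ_j f in weak
L^{p₂}; by a Bernstein inequality (`norm_le_of_weakBound`) it also bounds them by B 2^(jnσ) in sup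
norm, hence, for finite r ≥ p₂, by B 2^(-jl) in weak L^r, with l = n(1/r - σ).

Suppose p₁ < ∞ and σ ≥ 0. If l > 0, the pieces above J sum to f - L_J f in weak L^r
(`exists_weakBound_high`), because L_J f → f almost everywhere (`ae_tendsto_lowPart`). At each level
α, choosing J so that |L_J f| ≤ α/2 puts f in weak L^m with m = r + l r p₁/n
(`exists_weakBound_combine`). The second index 1 is gained by interpolation: weak bounds at
exponents strictly on either side of p give L^{p,1} (`lorentzNorm_one_le`). For r > θp the
differences p - p₁ and m - p both have the sign of 1 - σp₁, nonzero exactly because 1/p₁ ≠ σ.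

If p₁ < ∞ and σ < 0, the same argument in sup norm shows that f is bounded, and L^∞ replaces weak
L^m. If p₁ = ∞, then σ > 0 and the pieces are summable in sup norm as j → -∞, so L_J f tends to a
constant c, and L_J f - c = O(B 2^(Jnσ)) replaces the bound on L_J f. This places f - c in weak
L^{1/σ}, which is interpolated with L^∞. -/

namespace LorentzGN

/-! ### Schwartz multipliers and their kernels, uniformly over dyadic scales -/

section Kernels

variable {n : ℕ}

/-- Precomposition with the dilation `ξ ↦ 2 ^ j • ξ`. -/
noncomputable def dil (j : ℤ) : 𝓢(Rn n, ℂ) →L[ℂ] 𝓢(Rn n, ℂ) :=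
  SchwartzMap.compCLMOfContinuousLinearEquiv ℂ
    (ContinuousLinearEquiv.smulLeft (R₁ := ℝ) (M₁ := Rn n)
      (Units.mk0 ((2 : ℝ) ^ j) (by positivity)))

lemma dil_apply (j : ℤ) (m : 𝓢(Rn n, ℂ)) (ξ : Rn n) : dil j m ξ = m ((2 : ℝ) ^ j • ξ) := rfl

lemma fourierInv_eq_dil (j : ℤ) (m : 𝓢(Rn n, ℂ)) (x : Rn n) :
    (𝓕⁻ m : 𝓢(Rn n, ℂ)) x =
      ((2 : ℝ) ^ j) ^ n • (𝓕⁻ (dil j m) : 𝓢(Rn n, ℂ)) ((2 : ℝ) ^ j • x) := by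
  have h2 : (0 : ℝ) < 2 ^ j := by positivity
  rw [SchwartzMap.fourierInv_coe, SchwartzMap.fourierInv_coe, Real.fourierInv_eq',
    Real.fourierInv_eq']
  have h := Measure.integral_comp_smul (volume : Measure (Rn n))
    (fun v : Rn n => Complex.exp (↑(2 * Real.pi * inner ℝ v x) * Complex.I) • m v) ((2 : ℝ) ^ j)
  simp only [finrank_euclideanSpace, Fintype.card_fin] at h
  have h3 : ∀ v : Rn n, inner ℝ ((2 : ℝ) ^ j • v) x = inner ℝ v ((2 : ℝ) ^ j • x) := by
    intro v
    rw [real_inner_smul_left, real_inner_smul_right]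
  simp only [h3] at h
  simp only [dil_apply]
  rw [h, abs_of_pos (by positivity), smul_smul, mul_inv_cancel₀ (by positivity), one_smul]

/-- The profile `2 ^ (j n) (1 + 2 ^ j |x|) ^ (-(n + 1))` dominating kernels at scale `2 ^ (-j)`. -/
noncomputable def profile (j : ℤ) (x : Rn n) : ℝ :=
  ((2 : ℝ) ^ j) ^ n * ((1 + ‖(2 : ℝ) ^ j • x‖) ^ (n + 1))⁻¹

lemma profile_nonneg (j : ℤ) (x : Rn n) : 0 ≤ profile j x := by
  unfold profile; positivity

lemma profile_le (j : ℤ) (x : Rn n) : profile j x ≤ ((2 : ℝ) ^ j) ^ n := by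
  unfold profile
  refine mul_le_of_le_one_right (by positivity) (inv_le_one_of_one_le₀ (one_le_pow₀ ?_))
  linarith [norm_nonneg ((2 : ℝ) ^ j • x)]

lemma continuous_profile (j : ℤ) : Continuous (profile (n := n) j) := by
  unfold profile
  refine continuous_const.mul (Continuous.inv₀ (by fun_prop) fun x => ?_)
  positivity

/-- The exponent `n + 1` exceeds the dimension, so the profile is integrable; its prefactor makes
the mass independent of the scale. -/
lemma exists_integral_profile_le (n : ℕ) : ∃ W : ℝ, 0 < W ∧ ∀ j : ℤ,
    ∫⁻ x : Rn n, ENNReal.ofReal (profile j x) ≤ ENNReal.ofReal W := by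
  have hint : Integrable (fun x : Rn n => ((1 + ‖x‖) ^ (n + 1))⁻¹) := by
    have h := integrable_one_add_norm (E := Rn n) (μ := volume) (r := n + 1) (by simp)
    refine h.congr (ae_of_all _ fun x => ?_)
    have h1 : (0 : ℝ) < 1 + ‖x‖ := by positivity
    simp only
    rw [Real.rpow_neg h1.le]
    norm_cast
  refine ⟨(∫ x : Rn n, ((1 + ‖x‖) ^ (n + 1))⁻¹) + 1, ?_, fun j => ?_⟩
  · have : 0 ≤ ∫ x : Rn n, ((1 + ‖x‖) ^ (n + 1))⁻¹ := integral_nonneg fun x => by positivity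
    linarith
  · have h2 : (0 : ℝ) < 2 ^ j := by positivity
    have hint' : Integrable (profile (n := n) j) :=
      (hint.comp_smul h2.ne').const_mul _
    rw [← ofReal_integral_eq_lintegral_ofReal hint' (ae_of_all _ (profile_nonneg j))]
    apply ENNReal.ofReal_le_ofReal
    have h := Measure.integral_comp_smul (volume : Measure (Rn n))
      (fun x : Rn n => ((1 + ‖x‖) ^ (n + 1))⁻¹) ((2 : ℝ) ^ j)
    simp only [finrank_euclideanSpace, Fintype.card_fin] at h
    unfold profile
    rw [integral_const_mul, h, abs_of_pos (by positivity), smul_eq_mul, ← mul_assoc,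
      mul_inv_cancel₀ (by positivity), one_mul]
    linarith

lemma bounded_weighted_sup {S : Set 𝓢(Rn n, ℂ)} (hS : Bornology.IsVonNBounded ℂ S) (k l : ℕ) :
    ∃ C : ℝ, 0 < C ∧ ∀ m ∈ S, ∀ x, ‖iteratedFDeriv ℝ l m x‖ ≤ C * ((1 + ‖x‖) ^ k)⁻¹ := by
  have hb := (schwartz_withSeminorms ℂ (Rn n) ℂ).isVonNBounded_iff_finset_seminorm_bounded.mp hS
    (Finset.Iic (k, l))
  obtain ⟨r, hr, h⟩ := hb
  refine ⟨2 ^ k * r, by positivity, fun m hm x => ?_⟩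
  have h1 := SchwartzMap.one_add_le_sup_seminorm_apply (𝕜 := ℂ) (m := (k, l)) le_rfl le_rfl m x
  rw [← div_eq_mul_inv, le_div_iff₀ (by positivity), mul_comm]
  exact h1.trans (by gcongr; exact (h m hm).le)

/-- The inverse Fourier transform is continuous on 𝓢, so it maps the bounded family of rescaled
multipliers to a bounded family. Undoing the dilation turns uniform Schwartz decay into domination
by `profile`. -/
lemma exists_kernel_bound {m : ℤ → 𝓢(Rn n, ℂ)}
    (hm : Bornology.IsVonNBounded ℂ (range fun j => dil j (m j))) :
    ∃ C : ℝ, 0 < C ∧ ∀ j x, ‖(𝓕⁻ (m j) : 𝓢(Rn n, ℂ)) x‖ ≤ C * profile j x := by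
  obtain ⟨C, hC, h⟩ := bounded_weighted_sup (hm.image (fourierInvCLM ℂ 𝓢(Rn n, ℂ))) (n + 1) 0
  refine ⟨C, hC, fun j x => ?_⟩
  have h1 := h _ ⟨_, ⟨j, rfl⟩, rfl⟩ ((2 : ℝ) ^ j • x)
  rw [norm_iteratedFDeriv_zero] at h1
  rw [fourierInv_eq_dil j, norm_smul, Real.norm_of_nonneg (by positivity)]
  unfold profile
  rw [mul_left_comm]
  exact mul_le_mul_of_nonneg_left h1 (by positivity)

/-- Mean value inequality on a ball of rescaled radius at most 1, over which the weight `1 + ‖·‖`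
changes by a factor of at most 2. It serves to show that low-frequency parts flatten out as j → -∞.
-/
lemma exists_kernel_lipschitz {m : ℤ → 𝓢(Rn n, ℂ)}
    (hm : Bornology.IsVonNBounded ℂ (range fun j => dil j (m j))) :
    ∃ C : ℝ, 0 < C ∧ ∀ j x h, ‖(2 : ℝ) ^ j • h‖ ≤ 1 →
      ‖(𝓕⁻ (m j) : 𝓢(Rn n, ℂ)) (x + h) - (𝓕⁻ (m j) : 𝓢(Rn n, ℂ)) x‖ ≤
        C * ‖(2 : ℝ) ^ j • h‖ * profile j x := by
  obtain ⟨C, hC, hb⟩ := bounded_weighted_sup (hm.image (fourierInvCLM ℂ 𝓢(Rn n, ℂ))) (n + 1) 1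
  refine ⟨C * 2 ^ (n + 1), by positivity, fun j x h hh => ?_⟩
  have h1 := hb _ ⟨_, ⟨j, rfl⟩, rfl⟩
  rw [fourierInv_eq_dil j (m j) (x + h), fourierInv_eq_dil j (m j) x, ← smul_sub, norm_smul,
    Real.norm_of_nonneg (by positivity), smul_add]
  rw [show fourierInvCLM ℂ 𝓢(Rn n, ℂ) (dil j (m j)) = 𝓕⁻ (dil j (m j)) from rfl] at h1
  generalize (2 : ℝ) ^ j • h = h' at hh ⊢
  set k : 𝓢(Rn n, ℂ) := 𝓕⁻ (dil j (m j))
  unfold profile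
  generalize (2 : ℝ) ^ j • x = x'
  have h3 : ∀ y ∈ Metric.closedBall x' ‖h'‖,
      ‖fderiv ℝ k y‖ ≤ C * 2 ^ (n + 1) * ((1 + ‖x'‖) ^ (n + 1))⁻¹ := by
    intro y hy
    have h4 := h1 y
    rw [norm_iteratedFDeriv_one] at h4
    refine h4.trans ?_
    rw [mul_assoc]
    gcongr
    rw [← div_eq_mul_inv, le_div_iff₀ (by positivity), inv_mul_le_iff₀ (by positivity),
      ← mul_pow]
    gcongr
    have : ‖x'‖ ≤ ‖y‖ + ‖h'‖ := by
      have := norm_sub_norm_le x' y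
      rw [mem_closedBall_iff_norm, norm_sub_rev] at hy
      linarith
    nlinarith [norm_nonneg y]
  have h5 := (convex_closedBall x' ‖h'‖).norm_image_sub_le_of_norm_fderiv_le
    (f := k) (fun y _ => k.differentiableAt) h3 (x := x') (y := x' + h')
    (by simp) (by simp)
  calc _ ≤ ((2 : ℝ) ^ j) ^ n * (C * 2 ^ (n + 1) * ((1 + ‖x'‖) ^ (n + 1))⁻¹ * ‖x' + h' - x'‖) := by
        gcongr
    _ = _ := by rw [add_sub_cancel_left]; ring

/-- A smooth bump equal to one on the unit ball and supported in the ball of radius two. -/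
noncomputable def bump (n : ℕ) : 𝓢(Rn n, ℂ) :=
  HasCompactSupport.toSchwartzMap
    (f := fun x => (((⟨1, 2, one_pos, one_lt_two⟩ : ContDiffBump (0 : Rn n)) x : ℝ) : ℂ))
    ((ContDiffBump.hasCompactSupport _).comp_left Complex.ofReal_zero)
    (Complex.ofRealCLM.contDiff.comp (ContDiffBump.contDiff _))

lemma bump_apply (ξ : Rn n) : bump n ξ =
    (((⟨1, 2, one_pos, one_lt_two⟩ : ContDiffBump (0 : Rn n)) ξ : ℝ) : ℂ) := rfl

lemma bump_eq_one {ξ : Rn n} (h : ‖ξ‖ ≤ 1) : bump n ξ = 1 := by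
  rw [bump_apply, ContDiffBump.one_of_mem_closedBall _ (by simpa using h), Complex.ofReal_one]

lemma bump_eq_zero {ξ : Rn n} (h : 2 ≤ ‖ξ‖) : bump n ξ = 0 := by
  rw [bump_apply, ContDiffBump.zero_of_le_dist _ (by simpa using h), Complex.ofReal_zero]

/-- Multiplication of Schwartz functions. -/
noncomputable def mulS (a b : 𝓢(Rn n, ℂ)) : 𝓢(Rn n, ℂ) := SchwartzMap.smulLeftCLM ℂ a b

lemma mulS_apply (a b : 𝓢(Rn n, ℂ)) (ξ : Rn n) : mulS a b ξ = a ξ * b ξ := by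
  unfold mulS
  rw [SchwartzMap.smulLeftCLM_apply_apply a.hasTemperateGrowth, smul_eq_mul]

/-- The bump at frequency scale `2 ^ j`. -/
noncomputable def bumpAt (n : ℕ) (j : ℤ) : 𝓢(Rn n, ℂ) := dil (-j) (bump n)

lemma bumpAt_eq_one {j : ℤ} {ξ : Rn n} (h : ‖ξ‖ ≤ 2 ^ j) : bumpAt n j ξ = 1 := by
  rw [bumpAt, dil_apply]
  apply bump_eq_one
  rw [norm_smul, Real.norm_of_nonneg (by positivity), zpow_neg, inv_mul_le_iff₀ (by positivity),
    mul_one]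
  exact h

lemma bumpAt_eq_zero {j : ℤ} {ξ : Rn n} (h : 2 ^ (j + 1) ≤ ‖ξ‖) : bumpAt n j ξ = 0 := by
  rw [bumpAt, dil_apply]
  apply bump_eq_zero
  rw [norm_smul, Real.norm_of_nonneg (by positivity), zpow_neg, le_inv_mul_iff₀ (by positivity)]
  rwa [zpow_add_one₀ two_ne_zero] at h

lemma dil_bumpAt (i j : ℤ) : dil i (bumpAt n j) = dil (i - j) (bump n) := by
  ext ξ
  rw [bumpAt, dil_apply, dil_apply, dil_apply, smul_smul, ← zpow_add₀ two_ne_zero]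
  congr 3
  ring

lemma dil_mulS (j : ℤ) (a b : 𝓢(Rn n, ℂ)) : dil j (mulS a b) = mulS (dil j a) (dil j b) := by
  ext ξ
  simp only [dil_apply, mulS_apply]

/-! ### Littlewood-Paley multipliers and low-frequency cut-offs -/

namespace LPFamily

variable (Φ : LPFamily n)

lemma eq_zero_of_lt {j : ℤ} {ξ : Rn n} (h : ‖ξ‖ < 2 ^ (j - 1)) : Φ.φ j ξ = 0 := by
  by_contra h0
  exact absurd (Φ.supp j (subset_tsupport _ h0)).1 (not_le.mpr h)

lemma eq_zero_of_gt {j : ℤ} {ξ : Rn n} (h : 2 ^ (j + 1) < ‖ξ‖) : Φ.φ j ξ = 0 := by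
  by_contra h0
  exact absurd (Φ.supp j (subset_tsupport _ h0)).2 (not_le.mpr h)

/-- The scaled hypothesis `bound` is a uniform bound on derivatives of the rescaled multipliers.
These live in the ball of radius 2, so the polynomial weight costs at most `2 ^ k`. -/
lemma isVonNBounded_dil : Bornology.IsVonNBounded ℂ (range fun j => dil j (Φ.φ j)) := by
  rw [(schwartz_withSeminorms ℂ (Rn n) ℂ).isVonNBounded_iff_seminorm_bounded]
  rintro ⟨k, l⟩
  obtain ⟨C, hC⟩ := Φ.bound l
  have hC0 : 0 ≤ C := (by positivity : (0 : ℝ) ≤ _).trans (hC 0 0)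
  refine ⟨2 ^ k * C + 1, by positivity, ?_⟩
  rintro _ ⟨j, rfl⟩
  refine lt_of_le_of_lt ?_ (lt_add_one _)
  refine SchwartzMap.seminorm_le_bound ℂ k l _ (by positivity) fun x => ?_
  have h1 : iteratedFDeriv ℝ l (dil j (Φ.φ j)) x =
      ((2 : ℝ) ^ j) ^ l • iteratedFDeriv ℝ l (Φ.φ j) ((2 : ℝ) ^ j • x) :=
    congrFun (iteratedFDeriv_comp_const_smul ((2 : ℝ) ^ j) ((Φ.φ j).smooth l)) x
  rw [h1, norm_smul, Real.norm_of_nonneg (by positivity)]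
  by_cases hx : ‖x‖ ≤ 2
  · have h2 := hC j ((2 : ℝ) ^ j • x)
    rw [zpow_mul, zpow_natCast] at h2
    gcongr
  · have h3 : iteratedFDeriv ℝ l (Φ.φ j) ((2 : ℝ) ^ j • x) = 0 := by
      by_contra h0
      have h4 := Φ.supp j (support_iteratedFDeriv_subset l h0)
      have h5 := h4.2
      rw [norm_smul, Real.norm_of_nonneg (by positivity), zpow_add_one₀ two_ne_zero] at h5
      exact hx (le_of_mul_le_mul_left h5 (by positivity))
    rw [h3, norm_zero, mul_zero, mul_zero]
    positivity

/-- The smooth low-frequency cut-off `∑_{i ≤ j} φ_i`. -/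
noncomputable def low (j : ℤ) : 𝓢(Rn n, ℂ) :=
  bumpAt n j + (Φ.φ j - mulS (bumpAt n j) (Φ.φ j)) - mulS (bumpAt n j) (Φ.φ (j + 1))

lemma low_apply (j : ℤ) (ξ : Rn n) : Φ.low j ξ =
    bumpAt n j ξ + (1 - bumpAt n j ξ) * Φ.φ j ξ - bumpAt n j ξ * Φ.φ (j + 1) ξ := by
  have : Φ.low j ξ = bumpAt n j ξ + (Φ.φ j ξ - mulS (bumpAt n j) (Φ.φ j) ξ) -
    mulS (bumpAt n j) (Φ.φ (j + 1)) ξ := rfl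
  rw [this, mulS_apply, mulS_apply]
  ring

/-- Every φ_i vanishes at the origin, so the value comes from the bump. It is what gives the
low-pass kernels integral one. -/
lemma low_zero (j : ℤ) : Φ.low j 0 = 1 := by
  rw [low_apply, bumpAt_eq_one (by rw [norm_zero]; positivity),
    Φ.eq_zero_of_lt (j := j + 1) (by rw [norm_zero]; positivity)]
  ring

/-- Multiply the partition of unity by the bump at scale j. The bump is 1 where φ_i lives for i < j
and 0 where it lives for i > j + 1, so only the terms j and j + 1 need correcting. Thus the infinite
sum is a finite combination of Schwartz functions. -/
lemma hasSum_low (j : ℤ) {ξ : Rn n} (hξ : ξ ≠ 0) :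
    HasSum (fun i => if i ≤ j then Φ.φ i ξ else 0) (Φ.low j ξ) := by
  have h1 := (Φ.sum_eq_one ξ hξ).mul_left (bumpAt n j ξ)
  have h2 : HasSum (fun i => ((if i ≤ j then 1 else 0) - bumpAt n j ξ) * Φ.φ i ξ)
      (∑ i ∈ {j, j + 1}, ((if i ≤ j then 1 else 0) - bumpAt n j ξ) * Φ.φ i ξ) :=
    hasSum_sum_of_ne_finset_zero (by
      intro i hi
      simp only [Finset.mem_insert, Finset.mem_singleton, not_or] at hi
      rcases lt_or_ge i j with h | h
      · rw [if_pos h.le]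
        rcases le_or_gt ‖ξ‖ (2 ^ j) with h3 | h3
        · rw [bumpAt_eq_one h3, sub_self, zero_mul]
        · rw [Φ.eq_zero_of_gt, mul_zero]
          refine lt_of_le_of_lt ?_ h3
          exact zpow_le_zpow_right₀ one_le_two (by omega)
      · have h' : j + 1 ≤ i - 1 := by omega
        rw [if_neg (by omega)]
        rcases lt_or_ge ‖ξ‖ (2 ^ (j + 1)) with h3 | h3
        · rw [Φ.eq_zero_of_lt, mul_zero]
          exact h3.trans_le (zpow_le_zpow_right₀ one_le_two h')
        · rw [bumpAt_eq_zero h3, sub_self, zero_mul])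
  rw [Finset.sum_pair (by simp)] at h2
  have h3 := h1.add h2
  have e1 : (fun i => if i ≤ j then Φ.φ i ξ else 0) = fun i => bumpAt n j ξ * Φ.φ i ξ +
      ((if i ≤ j then 1 else 0) - bumpAt n j ξ) * Φ.φ i ξ := by
    funext i
    split_ifs <;> ring
  have e2 : Φ.low j ξ = bumpAt n j ξ * 1 + (((if j ≤ j then 1 else 0) - bumpAt n j ξ) * Φ.φ j ξ +
      ((if j + 1 ≤ j then 1 else 0) - bumpAt n j ξ) * Φ.φ (j + 1) ξ) := by
    rw [low_apply, if_pos le_rfl, if_neg (by omega)]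
    ring
  rw [e1, e2]
  exact h3

lemma low_add_one (j : ℤ) : Φ.low (j + 1) = Φ.low j + Φ.φ (j + 1) := by
  ext ξ
  change _ = Φ.low j ξ + Φ.φ (j + 1) ξ
  by_cases hξ : ξ = 0
  · subst hξ
    rw [low_zero, low_zero, Φ.eq_zero_of_lt (j := j + 1) (by rw [norm_zero]; positivity), add_zero]
  · have h1 := Φ.hasSum_low (j + 1) hξ
    have h2 := (Φ.hasSum_low j hξ).add (hasSum_ite_eq (j + 1) (Φ.φ (j + 1) ξ))
    refine h1.unique ?_
    convert h2 using 2 with i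
    rcases lt_trichotomy i (j + 1) with h | h | h
    · rw [if_pos h.le, if_pos (by omega), if_neg h.ne, add_zero]
    · subst h; simp
    · rw [if_neg (by omega), if_neg (by omega), if_neg (by omega), add_zero]

/-- Once rescaled, the cut-off is a fixed expression in one bump and the bounded family of rescaled
φ_j, with one extra dilation for φ_{j+1}. Dilation and multiplication by the bump are continuous on
𝓢. -/
lemma isVonNBounded_dil_low : Bornology.IsVonNBounded ℂ (range fun j => dil j (Φ.low j)) := by
  have h0 : Bornology.IsVonNBounded ℂ {bump n} := Bornology.isVonNBounded_singleton _
  have h1 := Φ.isVonNBounded_dil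
  have h2 := h1.image (SchwartzMap.smulLeftCLM ℂ (bump n))
  have h3 := h2.image (dil 1)
  have h4 := (h1.image (dil 1)).image (SchwartzMap.smulLeftCLM ℂ (bump n))
  have h1' : Bornology.IsVonNBounded ℂ (range fun j => dil (j + 1) (Φ.φ (j + 1))) :=
    h1.subset (by rintro _ ⟨j, rfl⟩; exact ⟨j + 1, rfl⟩)
  have h5 := (h1'.image (dil (-1))).image (SchwartzMap.smulLeftCLM ℂ (bump n))
  refine ((h0.add (h1.sub h2)).sub h5).subset ?_
  rintro _ ⟨j, rfl⟩
  refine ⟨_, ⟨_, rfl, _, ⟨_, ⟨j, rfl⟩, _, ⟨_, ⟨j, rfl⟩, rfl⟩, rfl⟩, rfl⟩, _,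
    ⟨_, ⟨_, ⟨j, rfl⟩, rfl⟩, rfl⟩, ?_⟩
  have e1 : dil j (mulS (bumpAt n j) (Φ.φ j)) = mulS (bump n) (dil j (Φ.φ j)) := by
    rw [dil_mulS, dil_bumpAt, sub_self]
    congr 1
    ext ξ; simp [dil_apply]
  have e2 : dil j (mulS (bumpAt n j) (Φ.φ (j + 1))) =
      mulS (bump n) (dil (-1) (dil (j + 1) (Φ.φ (j + 1)))) := by
    rw [dil_mulS, dil_bumpAt, sub_self]
    ext ξ
    simp only [mulS_apply, dil_apply, smul_smul, ← zpow_add₀ (two_ne_zero (α := ℝ))]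
    simp
  have e3 : dil j (bumpAt n j) = bump n := by
    rw [dil_bumpAt, sub_self]
    ext ξ; simp [dil_apply]
  simp only [low, map_sub, map_add, e1, e2, e3]
  rfl

end LPFamily

/-- The family consists of a single function. The shift to `j + 1` makes the bump equal to 1 on the
whole support of φ_j, as the reproducing identity requires. -/
lemma isVonNBounded_dil_bumpAt :
    Bornology.IsVonNBounded ℂ (range fun j => dil j (bumpAt n (j + 1))) := by
  refine (Bornology.isVonNBounded_singleton (dil (-1) (bump n))).subset ?_
  rintro _ ⟨j, rfl⟩
  simp only [dil_bumpAt, mem_singleton_iff]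
  congr 2
  ring

lemma integral_fourierInv (m : 𝓢(Rn n, ℂ)) : ∫ x, (𝓕⁻ m : 𝓢(Rn n, ℂ)) x = m 0 := by
  have h : (𝓕 (𝓕⁻ m : 𝓢(Rn n, ℂ)) : 𝓢(Rn n, ℂ)) 0 = m 0 := by
    rw [FourierTransform.fourier_fourierInv_eq]
  rw [← h, SchwartzMap.fourier_coe, Real.fourier_eq']
  simp

/-- The reproducing identity `φ^∨ = χ^∨ ∗ φ^∨` when `χ = 1` on the support of `φ`. -/
lemma fourierInv_reproduce (χ m : 𝓢(Rn n, ℂ)) (h : ∀ ξ, χ ξ * m ξ = m ξ) (x : Rn n) :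
    ∫ y, (𝓕⁻ χ : 𝓢(Rn n, ℂ)) y * (𝓕⁻ m : 𝓢(Rn n, ℂ)) (x - y) = (𝓕⁻ m : 𝓢(Rn n, ℂ)) x := by
  have h1 : SchwartzMap.convolution (ContinuousLinearMap.mul ℂ ℂ) (𝓕⁻ χ : 𝓢(Rn n, ℂ))
      (𝓕⁻ m : 𝓢(Rn n, ℂ)) = 𝓕⁻ m := by
    have h2 : 𝓕 (SchwartzMap.convolution (ContinuousLinearMap.mul ℂ ℂ) (𝓕⁻ χ : 𝓢(Rn n, ℂ))
        (𝓕⁻ m : 𝓢(Rn n, ℂ))) = m := by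
      rw [SchwartzMap.fourier_convolution, FourierTransform.fourier_fourierInv_eq,
        FourierTransform.fourier_fourierInv_eq]
      ext ξ
      rw [SchwartzMap.pairing_apply_apply]
      exact h ξ
    conv_rhs => rw [← h2]
    rw [FourierTransform.fourierInv_fourier_eq]
  have h3 := DFunLike.congr_fun h1 x
  rw [SchwartzMap.convolution_apply] at h3
  exact h3

end Kernels

/-! ### Weak-type bounds, Lorentz norms and interpolation -/

section LorentzBounds

variable {n : ℕ}

/-- The weak-type estimate `μ_g(α) ≤ U α ^ (-a)`. -/
def WeakBound (g : Rn n → ℂ) (a U : ℝ) : Prop :=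
  ∀ α : ℝ, 0 < α → distrib g α ≤ ENNReal.ofReal (U * α ^ (-a))

lemma distrib_eq_zero_iff {f : Rn n → ℂ} {α : ℝ} :
    distrib f α = 0 ↔ ∀ᵐ x, ‖f x‖ ≤ α := by
  rw [distrib, ae_iff]
  simp only [not_le]

lemma WeakBound.of_lorentzNorm_le {f : Rn n → ℂ} {P A : ℝ} (hP : 0 < P) (hA : 0 ≤ A)
    (h : lorentzNorm f (ENNReal.ofReal P) ∞ ≤ ENNReal.ofReal A) : WeakBound f P (A ^ P) := by
  intro α hα
  rw [lorentzNorm, if_neg ENNReal.ofReal_ne_top, if_pos rfl, ENNReal.toReal_ofReal hP.le] at h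
  have h1 := (le_iSup₂ (f := fun (α : ℝ) (_ : 0 < α) =>
    ENNReal.ofReal α * distrib f α ^ (1 / P)) α hα).trans h
  have h2 : distrib f α ^ (1 / P) ≤ ENNReal.ofReal (A / α) := by
    rw [ENNReal.ofReal_div_of_pos hα, ENNReal.le_div_iff_mul_le (by simp [hα]) (by simp), mul_comm]
    exact h1
  have h3 := ENNReal.rpow_le_rpow h2 hP.le
  rw [← ENNReal.rpow_mul, one_div_mul_cancel hP.ne', ENNReal.rpow_one,
    ENNReal.ofReal_rpow_of_nonneg (by positivity) hP.le] at h3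
  rwa [Real.rpow_neg hα.le, ← div_eq_mul_inv, ← Real.div_rpow hA hα.le]

lemma ae_le_of_lorentzNorm_top_lt {f : Rn n → ℂ} {A : ℝ}
    (h : lorentzNorm f ∞ ∞ < ENNReal.ofReal A) : ∀ᵐ x, ‖f x‖ ≤ A := by
  rw [lorentzNorm, if_pos rfl, if_pos rfl] at h
  simp only [iInf_lt_iff] at h
  obtain ⟨α, h1, h2, h3⟩ := h
  filter_upwards [distrib_eq_zero_iff.mp h2] with x hx
  have h4 : (α : ℝ≥0∞) < (A.toNNReal : ℝ≥0∞) := h3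
  rw [ENNReal.coe_lt_coe, Real.lt_toNNReal_iff_coe_lt] at h4
  exact hx.trans h4.le

lemma lorentzNorm_top_le {f : Rn n → ℂ} {G : ℝ} (hG : 0 < G) (h : ∀ᵐ x, ‖f x‖ ≤ G) :
    lorentzNorm f ∞ ∞ ≤ ENNReal.ofReal G := by
  rw [lorentzNorm, if_pos rfl, if_pos rfl]
  refine (iInf₂_le G.toNNReal (Real.toNNReal_pos.mpr hG)).trans (iInf_le_of_le ?_ le_rfl)
  rw [Real.coe_toNNReal _ hG.le, distrib_eq_zero_iff]
  exact h

lemma lorentzNorm_one_eq (f : Rn n → ℂ) {P : ℝ} (hP : 0 < P) :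
    lorentzNorm f (ENNReal.ofReal P) 1 =
      ENNReal.ofReal P * ∫⁻ α in Ioi (0 : ℝ), distrib f α ^ (1 / P) := by
  rw [lorentzNorm, if_neg ENNReal.ofReal_ne_top, if_neg ENNReal.one_ne_top,
    ENNReal.toReal_ofReal hP.le]
  simp only [ENNReal.toReal_one, ENNReal.rpow_one, div_one]
  congr 1
  refine setLIntegral_congr_fun measurableSet_Ioi fun α hα => ?_
  rw [mul_comm]
  exact ENNReal.mul_div_cancel_right (by simpa using hα) (by simp)

lemma lorentzNorm_one_one {f : Rn n → ℂ} (hf : AEStronglyMeasurable f volume) :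
    lorentzNorm f 1 1 = ∫⁻ x, ‖f x‖ₑ := by
  have h := lorentzNorm_one_eq f one_pos
  rw [ENNReal.ofReal_one] at h
  rw [h, one_mul]
  simp only [div_one, ENNReal.rpow_one]
  have h1 := lintegral_eq_lintegral_meas_lt volume (f := fun x => ‖f x‖)
    (ae_of_all _ fun x => norm_nonneg _) hf.norm.aemeasurable
  simp only [ofReal_norm] at h1
  rw [h1]
  rfl

lemma WeakBound.of_integral {f : Rn n → ℂ} (hf : AEStronglyMeasurable f volume) {A : ℝ}
    (h : ∫⁻ x, ‖f x‖ₑ ≤ ENNReal.ofReal A) : WeakBound f 1 A := by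
  intro α hα
  have h1 := meas_ge_le_lintegral_div (μ := volume) hf.enorm (ε := ENNReal.ofReal α)
    (by simpa using hα) (by simp)
  have h2 : distrib f α ≤ volume {x | ENNReal.ofReal α ≤ ‖f x‖ₑ} := by
    refine measure_mono fun x hx => ?_
    rw [mem_ofPred_eq, ← ofReal_norm]
    exact ENNReal.ofReal_le_ofReal (le_of_lt hx)
  refine h2.trans (h1.trans ?_)
  rw [Real.rpow_neg_one, ← div_eq_mul_inv, ENNReal.ofReal_div_of_pos hα]
  gcongr

/-- The power `α ^ (-(a / P))` is integrable at 0 because `a < P`; in the companion lemma the power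
is integrable at infinity because `P < b`. -/
lemma lintegral_distrib_low {g : Rn n → ℂ} {a P U : ℝ} (ha : a < P) (hP : 0 < P)
    (hU : 0 ≤ U) (h : WeakBound g a U) {t : ℝ} (ht : 0 < t) :
    ∫⁻ α in Ioc 0 t, distrib g α ^ (1 / P) ≤
      ENNReal.ofReal ((1 - a / P)⁻¹ * (U ^ (1 / P) * t ^ (1 - a / P))) := by
  have hlt : a / P < 1 := by rwa [div_lt_one hP]
  calc ∫⁻ α in Ioc 0 t, distrib g α ^ (1 / P)
      ≤ ∫⁻ α in Ioc 0 t, ENNReal.ofReal (U ^ (1 / P) * α ^ (-(a / P))) := by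
        refine setLIntegral_mono' measurableSet_Ioc fun α hα => ?_
        refine (ENNReal.rpow_le_rpow (h α hα.1) (by positivity)).trans ?_
        have h0 : 0 < α := hα.1
        rw [ENNReal.ofReal_rpow_of_nonneg (by positivity) (by positivity),
          Real.mul_rpow hU (by positivity), ← Real.rpow_mul h0.le]
        apply le_of_eq
        congr 3
        ring
    _ = _ := by
        have hi : IntervalIntegrable (fun α : ℝ => U ^ (1 / P) * α ^ (-(a / P))) volume 0 t :=
          (intervalIntegral.intervalIntegrable_rpow' (by linarith)).const_mul _
        rw [intervalIntegrable_iff_integrableOn_Ioc_of_le ht.le] at hi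
        rw [← ofReal_integral_eq_lintegral_ofReal hi]
        · rw [← intervalIntegral.integral_of_le ht.le, intervalIntegral.integral_const_mul,
            integral_rpow (Or.inl (by linarith)), Real.zero_rpow (by linarith)]
          congr 1
          rw [neg_add_eq_sub]
          ring
        · refine (ae_restrict_iff' measurableSet_Ioc).mpr (ae_of_all _ fun α hα => ?_)
          have h0 : 0 < α := hα.1
          positivity

lemma lintegral_distrib_high {g : Rn n → ℂ} {b P V : ℝ} (hb : P < b) (hP : 0 < P)
    (hV : 0 ≤ V) (h : WeakBound g b V) {t : ℝ} (ht : 0 < t) :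
    ∫⁻ α in Ioi t, distrib g α ^ (1 / P) ≤
      ENNReal.ofReal ((b / P - 1)⁻¹ * (V ^ (1 / P) * t ^ (1 - b / P))) := by
  have hlt : 1 < b / P := by rwa [one_lt_div hP]
  calc ∫⁻ α in Ioi t, distrib g α ^ (1 / P)
      ≤ ∫⁻ α in Ioi t, ENNReal.ofReal (V ^ (1 / P) * α ^ (-(b / P))) := by
        refine setLIntegral_mono' measurableSet_Ioi fun α hα => ?_
        have h0 : 0 < α := ht.trans hα
        refine (ENNReal.rpow_le_rpow (h α h0) (by positivity)).trans ?_
        rw [ENNReal.ofReal_rpow_of_nonneg (by positivity) (by positivity),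
          Real.mul_rpow hV (by positivity), ← Real.rpow_mul h0.le]
        apply le_of_eq
        congr 3
        ring
    _ = _ := by
        have hi : IntegrableOn (fun α : ℝ => V ^ (1 / P) * α ^ (-(b / P))) (Ioi t) :=
          (integrableOn_Ioi_rpow_of_lt (by linarith) ht).const_mul _
        rw [← ofReal_integral_eq_lintegral_ofReal hi]
        · rw [integral_const_mul, integral_Ioi_rpow_of_lt (by linarith) ht]
          congr 1
          have h1 : -(b / P) + 1 = -(b / P - 1) := by ring
          have h2 : 1 - b / P = -(b / P - 1) := by ring
          rw [h1, h2, neg_div_neg_eq]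
          ring
        · refine (ae_restrict_iff' measurableSet_Ioi).mpr (ae_of_all _ fun α hα => ?_)
          have h0 : 0 < α := ht.trans hα
          positivity

lemma lorentzNorm_one_le_of_top {a P : ℝ} (ha : a < P) (hP : 0 < P) :
    ∃ C : ℝ, 0 < C ∧ ∀ (g : Rn n → ℂ) (U Y : ℝ), 0 < U → 0 < Y → WeakBound g a U →
      (∀ᵐ x, ‖g x‖ ≤ Y) →
      lorentzNorm g (ENNReal.ofReal P) 1 ≤
        ENNReal.ofReal (C * (U ^ (1 / P) * Y ^ (1 - a / P))) := by
  have hlt : 0 < 1 - a / P := by rw [sub_pos, div_lt_one hP]; exact ha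
  refine ⟨P * (1 - a / P)⁻¹, by positivity, fun g U Y hU hY hg hgY => ?_⟩
  rw [lorentzNorm_one_eq g hP, mul_assoc, ENNReal.ofReal_mul hP.le]
  gcongr
  rw [← Ioc_union_Ioi_eq_Ioi hY.le]
  refine (lintegral_union_le _ _ _).trans ?_
  have h0 : ∫⁻ α in Ioi Y, distrib g α ^ (1 / P) = 0 := by
    rw [setLIntegral_congr_fun (g := fun _ => 0) measurableSet_Ioi, lintegral_zero]
    intro α hα
    have : distrib g α = 0 := by
      rw [distrib_eq_zero_iff]
      filter_upwards [hgY] with x hx using hx.trans (le_of_lt hα)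
    simp only [this]
    exact ENNReal.zero_rpow_of_pos (by positivity)
  rw [h0, add_zero]
  exact lintegral_distrib_low ha hP hU.le hg hY

/-- Use the weak bound with the smaller exponent at low levels and the other at high levels. Strict
inequalities on both sides make both integrals converge, which yields second index 1 from weak data.
-/
lemma lorentzNorm_one_le {a b P : ℝ} (ha : a < P) (hb : P < b) (hP : 0 < P) :
    ∃ C : ℝ, 0 < C ∧ ∀ (g : Rn n → ℂ) (U V : ℝ), 0 < U → 0 < V → WeakBound g a U →
      WeakBound g b V →
      lorentzNorm g (ENNReal.ofReal P) 1 ≤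
        ENNReal.ofReal (C * (U ^ ((b - P) / (P * (b - a))) * V ^ ((P - a) / (P * (b - a))))) := by
  have h1 : 0 < 1 - a / P := by rw [sub_pos, div_lt_one hP]; exact ha
  have h2 : 0 < b / P - 1 := by rw [sub_pos, one_lt_div hP]; exact hb
  have hba : 0 < b - a := by linarith
  refine ⟨P * ((1 - a / P)⁻¹ + (b / P - 1)⁻¹), by positivity, fun g U V hU hV hgU hgV => ?_⟩
  rw [lorentzNorm_one_eq g hP, mul_assoc, ENNReal.ofReal_mul hP.le]
  gcongr
  -- The level at which `U * t ^ (-a) = V * t ^ (-b)`; both ranges then contribute the same product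
  -- of powers.
  set t : ℝ := (V / U) ^ (1 / (b - a)) with ht
  have ht0 : 0 < t := by positivity
  have e1 : U ^ (1 / P) * t ^ (1 - a / P) =
      U ^ ((b - P) / (P * (b - a))) * V ^ ((P - a) / (P * (b - a))) := by
    rw [ht, ← Real.rpow_mul (by positivity), Real.div_rpow hV.le hU.le, mul_div_assoc',
      mul_comm, mul_div_assoc, ← Real.rpow_sub hU, mul_comm]
    congr 2 <;> (field_simp; try ring)
  have e2 : V ^ (1 / P) * t ^ (1 - b / P) =
      U ^ ((b - P) / (P * (b - a))) * V ^ ((P - a) / (P * (b - a))) := by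
    rw [ht, ← Real.rpow_mul (by positivity), Real.div_rpow hV.le hU.le,
      div_eq_mul_inv (V ^ (1 / (b - a) * (1 - b / P))),
      ← Real.rpow_neg hU.le, ← mul_assoc, ← Real.rpow_add hV, mul_comm]
    congr 2 <;> (field_simp; try ring)
  rw [← Ioc_union_Ioi_eq_Ioi ht0.le]
  refine (lintegral_union_le _ _ _).trans ?_
  refine (add_le_add (lintegral_distrib_low ha hP hU.le hgU ht0)
    (lintegral_distrib_high hb hP hV.le hgV ht0)).trans ?_
  rw [e1, e2, ← ENNReal.ofReal_add (by positivity) (by positivity), ← add_mul]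

/-- Large-value tails of a function in weak `L^P`, `P > 1`, are integrable. -/
lemma exists_tail_bound {P : ℝ} (hP : 1 < P) :
    ∃ C : ℝ, 0 < C ∧ ∀ (f : Rn n → ℂ) (U : ℝ), AEStronglyMeasurable f volume → 0 ≤ U →
      WeakBound f P U → ∀ t : ℝ, 0 < t →
      ∫⁻ x in {x | t < ‖f x‖}, ‖f x‖ₑ ≤ ENNReal.ofReal (C * (U * t ^ (1 - P))) := by
  have hr : (2 : ℝ) ^ (1 - P) < 1 := Real.rpow_lt_one_of_one_lt_of_neg one_lt_two (by linarith)
  have hr0 : (0 : ℝ) < 2 ^ (1 - P) := by positivity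
  have hs := summable_geometric_of_lt_one hr0.le hr
  refine ⟨2 * (1 - 2 ^ (1 - P))⁻¹, by have := sub_pos.mpr hr; positivity,
    fun f U hf hU h t ht => ?_⟩
  -- Only the term of the dyadic shell `2 ^ i * t < ‖f x‖ ≤ 2 ^ (i + 1) * t` containing x is needed.
  -- After integration the terms have ratio `2 ^ (1 - P) < 1`.
  have hpt : ∀ x ∈ {x | t < ‖f x‖}, ‖f x‖ₑ ≤ ∑' i : ℕ,
      ({x | 2 ^ i * t < ‖f x‖}).indicator (fun _ => ENNReal.ofReal (2 ^ (i + 1) * t)) x := by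
    intro x hx
    have hx' : t < ‖f x‖ := hx
    have h1 : 1 < ‖f x‖ / t := by rwa [one_lt_div ht]
    obtain ⟨N, hN⟩ := pow_unbounded_of_one_lt (‖f x‖ / t) (one_lt_two (α := ℝ))
    classical
    have hex : ∃ N : ℕ, ‖f x‖ / t ≤ 2 ^ N := ⟨N, hN.le⟩
    obtain ⟨i, hi⟩ : ∃ i, Nat.find hex = i + 1 := by
      refine Nat.exists_eq_succ_of_ne_zero fun h0 => ?_
      have := Nat.find_spec hex
      rw [h0, pow_zero] at this
      linarith
    have h2 := Nat.find_spec hex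
    rw [hi, div_le_iff₀ ht] at h2
    have h3 := Nat.find_min hex (m := i) (by omega)
    rw [not_le, lt_div_iff₀ ht] at h3
    refine le_trans ?_ (ENNReal.le_tsum i)
    rw [indicator_of_mem (by exact h3), ← ofReal_norm]
    exact ENNReal.ofReal_le_ofReal h2
  have hms : ∀ s : ℝ, NullMeasurableSet {x | s < ‖f x‖} := fun s =>
    nullMeasurableSet_lt aemeasurable_const hf.norm.aemeasurable
  calc ∫⁻ x in {x | t < ‖f x‖}, ‖f x‖ₑ
      ≤ ∫⁻ x, ∑' i : ℕ,
          ({x | 2 ^ i * t < ‖f x‖}).indicator (fun _ => ENNReal.ofReal (2 ^ (i + 1) * t)) x := by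
        refine le_trans ?_ (setLIntegral_le_lintegral {x | t < ‖f x‖} _)
        exact lintegral_mono_ae ((ae_restrict_iff'₀ (hms t)).mpr (ae_of_all _ hpt))
    _ = ∑' i : ℕ, ENNReal.ofReal (2 ^ (i + 1) * t) * distrib f (2 ^ i * t) := by
        rw [lintegral_tsum fun i => (aemeasurable_const.indicator₀ (hms _))]
        congr 1
        funext i
        rw [lintegral_indicator_const₀ (hms _)]
        rfl
    _ ≤ ∑' i : ℕ, ENNReal.ofReal (2 * (U * t ^ (1 - P)) * (2 ^ (1 - P)) ^ i) := by
        refine ENNReal.tsum_le_tsum fun i => ?_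
        refine (mul_le_mul_right (h _ (by positivity)) _).trans ?_
        rw [← ENNReal.ofReal_mul (by positivity)]
        apply ENNReal.ofReal_le_ofReal
        apply le_of_eq
        rw [Real.mul_rpow (by positivity) ht.le, ← Real.rpow_natCast, ← Real.rpow_natCast,
          ← Real.rpow_natCast, ← Real.rpow_mul two_pos.le, ← Real.rpow_mul two_pos.le]
        have e1 : t ^ (1 - P) = t * t ^ (-P) := by
          rw [sub_eq_add_neg, Real.rpow_add ht, Real.rpow_one]
        have e2 : (2 : ℝ) ^ ((1 - P) * (i : ℝ)) = 2 ^ (i : ℝ) * 2 ^ ((i : ℝ) * -P) := by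
          rw [← Real.rpow_add two_pos]; ring_nf
        rw [e1, e2]
        push_cast
        rw [Real.rpow_add two_pos, Real.rpow_one]
        ring
    _ = _ := by
        rw [← ENNReal.ofReal_tsum_of_nonneg (fun i => by positivity) (hs.mul_left _),
          tsum_mul_left, tsum_geometric_of_lt_one hr0.le hr]
        congr 1
        ring

/-- Averages of `f ∈ L^{p₁,q₁}` against a kernel of height `t` and bounded mass. -/
lemma exists_average_bound {p₁ q₁ : ℝ≥0∞} (hp : 1 ≤ p₁) (hq : 1 < p₁ → q₁ = ∞)
    (hq' : p₁ = 1 → q₁ = 1) {W : ℝ} (hW : 0 < W) :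
    ∃ C : ℝ, 0 < C ∧ ∀ (f : Rn n → ℂ) (A : ℝ), AEStronglyMeasurable f volume → 0 < A →
      lorentzNorm f p₁ q₁ < ENNReal.ofReal A → ∀ t : ℝ, 0 < t → ∀ K : Rn n → ℝ≥0∞,
      AEMeasurable K → (∀ y, K y ≤ ENNReal.ofReal t) → ∫⁻ y, K y ≤ ENNReal.ofReal W →
      ∫⁻ y, ‖f y‖ₑ * K y ≤ ENNReal.ofReal (C * (A * t ^ (p₁⁻¹).toReal)) := by
  by_cases hpt : p₁ = ∞
  · subst hpt
    rw [hq (by simp)]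
    refine ⟨W, hW, fun f A hf hA h t ht K hK hKt hKW => ?_⟩
    simp only [ENNReal.inv_top, ENNReal.toReal_zero, Real.rpow_zero, mul_one]
    calc ∫⁻ y, ‖f y‖ₑ * K y ≤ ∫⁻ y, ENNReal.ofReal A * K y := by
          refine lintegral_mono_ae ?_
          filter_upwards [ae_le_of_lorentzNorm_top_lt h] with y hy
          gcongr
          rw [← ofReal_norm]
          exact ENNReal.ofReal_le_ofReal hy
      _ = ENNReal.ofReal A * ∫⁻ y, K y := lintegral_const_mul'' _ hK
      _ ≤ ENNReal.ofReal A * ENNReal.ofReal W := by gcongr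
      _ = _ := by rw [← ENNReal.ofReal_mul hA.le, mul_comm]
  obtain ⟨P, hP1, rfl⟩ : ∃ P : ℝ, 1 ≤ P ∧ p₁ = ENNReal.ofReal P := by
    refine ⟨p₁.toReal, ?_, (ENNReal.ofReal_toReal hpt).symm⟩
    rwa [← ENNReal.ofReal_le_iff_le_toReal hpt, ENNReal.ofReal_one]
  have hP0 : 0 < P := by linarith
  have htail : ∃ C : ℝ, 0 < C ∧ ∀ (f : Rn n → ℂ) (A : ℝ), AEStronglyMeasurable f volume → 0 < A →
      lorentzNorm f (ENNReal.ofReal P) q₁ < ENNReal.ofReal A → ∀ t : ℝ, 0 < t →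
      ∫⁻ x in {x | t < ‖f x‖}, ‖f x‖ₑ ≤ ENNReal.ofReal (C * (A ^ P * t ^ (1 - P))) := by
    -- At exponent 1 a weak bound does not control the tail, which is why `q₁ = 1` there: the tail
    -- is bounded by the full L¹ norm.
    rcases hP1.eq_or_lt with h1 | h1
    · subst h1
      rw [hq' (by simp), ENNReal.ofReal_one]
      refine ⟨1, one_pos, fun f A hf hA h t ht => ?_⟩
      rw [lorentzNorm_one_one hf] at h
      rw [sub_self, Real.rpow_zero, Real.rpow_one, mul_one, one_mul]
      exact (setLIntegral_le_lintegral _ _).trans h.le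
    · rw [hq (by simpa using h1)]
      obtain ⟨C, hC, h⟩ := exists_tail_bound (n := n) h1
      exact ⟨C, hC, fun f A hf hA hfA t ht => h f (A ^ P) hf (by positivity)
        (WeakBound.of_lorentzNorm_le hP0 hA.le hfA.le) t ht⟩
  obtain ⟨C, hC, h⟩ := htail
  refine ⟨W + C, by positivity, fun f A hf hA hfA t ht K hK hKt hKW => ?_⟩
  -- The truncation height for which `A ^ P * s ^ (1 - P) * t = s`, so that small and large values
  -- of f contribute equally up to constants.
  set s : ℝ := A * t ^ (1 / P) with hs
  have hs0 : 0 < s := by positivity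
  have hms : NullMeasurableSet {x | s < ‖f x‖} :=
    nullMeasurableSet_lt aemeasurable_const hf.norm.aemeasurable
  have e1 : (((ENNReal.ofReal P)⁻¹).toReal) = 1 / P := by
    rw [ENNReal.toReal_inv, ENNReal.toReal_ofReal hP0.le, one_div]
  rw [e1]
  calc ∫⁻ y, ‖f y‖ₑ * K y
      ≤ ∫⁻ y, (ENNReal.ofReal s * K y +
          ({x | s < ‖f x‖}).indicator (fun y => ‖f y‖ₑ) y * ENNReal.ofReal t) := by
        refine lintegral_mono fun y => ?_
        by_cases hy : s < ‖f y‖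
        · rw [indicator_of_mem (by exact hy)]
          exact le_add_left (by gcongr; exact hKt y)
        · refine le_add_right ?_
          gcongr
          rw [← ofReal_norm]
          exact ENNReal.ofReal_le_ofReal (not_lt.mp hy)
    _ = ENNReal.ofReal s * (∫⁻ y, K y) +
          (∫⁻ x in {x | s < ‖f x‖}, ‖f x‖ₑ) * ENNReal.ofReal t := by
        rw [lintegral_add_left' (hK.const_mul _), lintegral_const_mul'' _ hK,
          lintegral_mul_const' _ _ ENNReal.ofReal_ne_top, lintegral_indicator₀ hms]
    _ ≤ ENNReal.ofReal s * ENNReal.ofReal W +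
          ENNReal.ofReal (C * (A ^ P * s ^ (1 - P))) * ENNReal.ofReal t := by
        gcongr
        exact h f A hf hA hfA s hs0
    _ = _ := by
        rw [← ENNReal.ofReal_mul hs0.le, ← ENNReal.ofReal_mul (by positivity),
          ← ENNReal.ofReal_add (by positivity) (by positivity)]
        congr 1
        have e2 : A ^ P * s ^ (1 - P) * t = A * t ^ (1 / P) := by
          rw [hs, Real.mul_rpow hA.le (by positivity), ← Real.rpow_mul ht.le, ← mul_assoc,
            ← Real.rpow_add hA, mul_assoc, ← Real.rpow_add_one ht.ne']
          congr 2
          · rw [add_sub_cancel, Real.rpow_one]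
          · field_simp; ring
        calc s * W + C * (A ^ P * s ^ (1 - P)) * t
            = s * W + C * (A ^ P * s ^ (1 - P) * t) := by ring
          _ = _ := by rw [e2, hs]; ring

end LorentzBounds

/-! ### Convolution, the reproducing formula and Bernstein inequalities -/

section Convolution

variable {n : ℕ}

/-- The convolution of a function with a kernel. -/
noncomputable def cv (f K : Rn n → ℂ) (x : Rn n) : ℂ := ∫ y, f y * K (x - y)

/-- The maximal averages of `f` at scale `2 ^ (-j)` are at most `D 2 ^ (j κ)`. -/
def AvgBound (f : Rn n → ℂ) (D κ : ℝ) : Prop :=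
  ∀ (j : ℤ) (x : Rn n), ∫⁻ y, ‖f y‖ₑ * ENNReal.ofReal (profile j (x - y)) ≤
    ENNReal.ofReal (D * 2 ^ ((j : ℝ) * κ))

lemma two_zpow_pow_rpow (j : ℤ) (n : ℕ) (e : ℝ) :
    (((2 : ℝ) ^ j) ^ n) ^ e = 2 ^ ((j : ℝ) * (n * e)) := by
  rw [← Real.rpow_intCast, ← Real.rpow_natCast, ← Real.rpow_mul two_pos.le,
    ← Real.rpow_mul two_pos.le, mul_assoc]

lemma lintegral_profile_sub (j : ℤ) (x : Rn n) :
    ∫⁻ y, ENNReal.ofReal (profile j (x - y)) = ∫⁻ y : Rn n, ENNReal.ofReal (profile j y) :=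
  lintegral_sub_left_eq_self (fun y => ENNReal.ofReal (profile j y)) x

lemma measurable_profile_sub (j : ℤ) (x : Rn n) :
    Measurable fun y => ENNReal.ofReal (profile j (x - y)) :=
  (((continuous_profile j).comp (continuous_const.sub continuous_id)).measurable).ennreal_ofReal

lemma exists_avgBound {p₁ q₁ : ℝ≥0∞} (hp : 1 ≤ p₁) (hq : 1 < p₁ → q₁ = ∞)
    (hq' : p₁ = 1 → q₁ = 1) :
    ∃ C : ℝ, 0 < C ∧ ∀ (f : Rn n → ℂ) (A : ℝ), AEStronglyMeasurable f volume → 0 < A →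
      lorentzNorm f p₁ q₁ < ENNReal.ofReal A → AvgBound f (C * A) (n * (p₁⁻¹).toReal) := by
  obtain ⟨W, hW, hWb⟩ := exists_integral_profile_le n
  obtain ⟨C, hC, h⟩ := exists_average_bound (n := n) hp hq hq' hW
  refine ⟨C, hC, fun f A hf hA hfA j x => ?_⟩
  refine (h f A hf hA hfA (((2 : ℝ) ^ j) ^ n) (by positivity) _
    (measurable_profile_sub j x).aemeasurable
    (fun y => ENNReal.ofReal_le_ofReal (profile_le j _))
    ((lintegral_profile_sub j x).trans_le (hWb j))).trans_eq ?_
  rw [two_zpow_pow_rpow, mul_assoc]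

lemma lintegral_mul_kernel_le {g : Rn n → ℝ≥0∞} {K : Rn n → ℂ} {C : ℝ} (hC : 0 ≤ C)
    {j : ℤ} (hK : ∀ z, ‖K z‖ ≤ C * profile j z) (x : Rn n) :
    ∫⁻ y, g y * ‖K (x - y)‖ₑ ≤
      ENNReal.ofReal C * ∫⁻ y, g y * ENNReal.ofReal (profile j (x - y)) := by
  rw [← lintegral_const_mul' _ _ ENNReal.ofReal_ne_top]
  refine lintegral_mono fun y => ?_
  rw [mul_left_comm, ← ENNReal.ofReal_mul hC, ← ofReal_norm]
  gcongr
  exact hK _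

lemma integrable_cv {f K : Rn n → ℂ} {C D κ : ℝ} (hf : AEStronglyMeasurable f volume)
    (hfD : AvgBound f D κ) (hKc : Continuous K) (hC : 0 ≤ C) {j : ℤ}
    (hK : ∀ z, ‖K z‖ ≤ C * profile j z) (x : Rn n) :
    Integrable fun y => f y * K (x - y) := by
  refine ⟨hf.mul (hKc.comp (continuous_const.sub continuous_id)).aestronglyMeasurable, ?_⟩
  rw [hasFiniteIntegral_iff_enorm]
  simp only [enorm_mul]
  refine (lintegral_mul_kernel_le hC hK x).trans_lt ?_
  exact ENNReal.mul_lt_top ENNReal.ofReal_lt_top ((hfD j x).trans_lt ENNReal.ofReal_lt_top)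

lemma enorm_cv_le {f K : Rn n → ℂ} {C : ℝ} (hC : 0 ≤ C) {j : ℤ}
    (hK : ∀ z, ‖K z‖ ≤ C * profile j z) (x : Rn n) :
    ‖cv f K x‖ₑ ≤
      ENNReal.ofReal C * ∫⁻ y, ‖f y‖ₑ * ENNReal.ofReal (profile j (x - y)) := by
  refine (enorm_integral_le_lintegral_enorm _).trans ?_
  simp only [enorm_mul]
  exact lintegral_mul_kernel_le hC hK x

lemma norm_cv_le {f K : Rn n → ℂ} {C D κ : ℝ} (hD : 0 ≤ D) (hfD : AvgBound f D κ)
    (hC : 0 ≤ C) {j : ℤ} (hK : ∀ z, ‖K z‖ ≤ C * profile j z) (x : Rn n) :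
    ‖cv f K x‖ ≤ C * D * 2 ^ ((j : ℝ) * κ) := by
  have h := (enorm_cv_le (f := f) hC hK x).trans (mul_le_mul_right (hfD j x) _)
  rw [← ENNReal.ofReal_mul hC, ← ofReal_norm,
    ENNReal.ofReal_le_ofReal_iff (by positivity)] at h
  rwa [mul_assoc]

lemma aestronglyMeasurable_cv {f K : Rn n → ℂ} (hf : AEStronglyMeasurable f volume)
    (hKc : Continuous K) : AEStronglyMeasurable (cv f K) volume := by
  have h : AEStronglyMeasurable (fun p : Rn n × Rn n => f p.2 * K (p.1 - p.2))
      (volume.prod volume) :=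
    hf.comp_snd.mul (hKc.comp (continuous_fst.sub continuous_snd)).aestronglyMeasurable
  exact h.integral_prod_right'

/-- Associativity of convolution transfers the reproducing identity from the kernel to its
convolution with f. The bound on averages of |f| gives the absolute convergence needed for Fubini.
-/
lemma cv_cv {f K ω : Rn n → ℂ} {C C' D κ W : ℝ} (hf : AEStronglyMeasurable f volume)
    (hfD : AvgBound f D κ) (hKc : Continuous K) (hC : 0 ≤ C) {j : ℤ}
    (hK : ∀ z, ‖K z‖ ≤ C * profile j z) (hωc : Continuous ω) (hC' : 0 ≤ C')
    (hω : ∀ z, ‖ω z‖ ≤ C' * profile j z)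
    (hW : ∫⁻ z : Rn n, ENNReal.ofReal (profile j z) ≤ ENNReal.ofReal W)
    (hrep : ∀ x, ∫ y, ω y * K (x - y) = K x) (x : Rn n) :
    cv (cv f K) ω x = cv f K x := by
  have hint : Integrable (Function.uncurry fun y z : Rn n => f z * K (y - z) * ω (x - y))
      (volume.prod volume) := by
    have hm : AEStronglyMeasurable (Function.uncurry fun y z : Rn n =>
        f z * K (y - z) * ω (x - y)) (volume.prod volume) :=
      (hf.comp_snd.mul (hKc.comp (continuous_fst.sub continuous_snd)).aestronglyMeasurable).mul
        (hωc.comp (continuous_const.sub continuous_fst)).aestronglyMeasurable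
    refine ⟨hm, ?_⟩
    rw [hasFiniteIntegral_iff_enorm, lintegral_prod _ hm.enorm]
    simp only [Function.uncurry, enorm_mul]
    calc ∫⁻ y, ∫⁻ z, ‖f z‖ₑ * ‖K (y - z)‖ₑ * ‖ω (x - y)‖ₑ
        = ∫⁻ y, (∫⁻ z, ‖f z‖ₑ * ‖K (y - z)‖ₑ) * ‖ω (x - y)‖ₑ := by
          refine lintegral_congr fun y => ?_
          rw [lintegral_mul_const' _ _ enorm_ne_top]
      _ ≤ ∫⁻ y, (ENNReal.ofReal C * ENNReal.ofReal (D * 2 ^ ((j : ℝ) * κ))) *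
            ‖ω (x - y)‖ₑ := by
          gcongr with y
          exact (lintegral_mul_kernel_le hC hK y).trans (mul_le_mul_right (hfD j y) _)
      _ ≤ ENNReal.ofReal C' * ∫⁻ y, (ENNReal.ofReal C *
            ENNReal.ofReal (D * 2 ^ ((j : ℝ) * κ))) * ENNReal.ofReal (profile j (x - y)) :=
          lintegral_mul_kernel_le hC' hω x
      _ < ∞ := by
          rw [lintegral_const_mul' _ _ (by finiteness), lintegral_profile_sub]
          have : ∫⁻ z : Rn n, ENNReal.ofReal (profile j z) < ∞ := hW.trans_lt (by finiteness)
          finiteness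
  calc cv (cv f K) ω x = ∫ y, ∫ z, f z * K (y - z) * ω (x - y) := by
        refine integral_congr_ae (ae_of_all _ fun y => ?_)
        simp only [cv]
        rw [integral_mul_const]
    _ = ∫ z, ∫ y, f z * K (y - z) * ω (x - y) := integral_integral_swap hint
    _ = cv f K x := by
        refine integral_congr_ae (ae_of_all _ fun z => ?_)
        simp only
        rw [← hrep (x - z), ← integral_const_mul,
          ← integral_sub_left_eq_self (fun y => f z * K (y - z) * ω (x - y)) volume x]
        refine integral_congr_ae (ae_of_all _ fun y => ?_)
        simp only
        rw [sub_sub_cancel, sub_right_comm]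
        ring

/-- A Bernstein inequality: a bounded function reproduced by a kernel at scale `2 ^ (-j)` is
controlled in the sup norm by its weak `L^a` norm. -/
lemma norm_le_of_weakBound {a C W : ℝ} (ha : 0 < a) (hC : 0 < C) (hW : 0 < W) :
    ∃ C' : ℝ, 0 < C' ∧ ∀ (F ω : Rn n → ℂ) (M₀ V : ℝ) (j : ℤ),
      AEStronglyMeasurable F volume → (∀ x, ‖F x‖ ≤ M₀) → (∀ x, cv F ω x = F x) →
      (∀ z, ‖ω z‖ ≤ C * profile j z) →
      (∫⁻ z : Rn n, ENNReal.ofReal (profile j z) ≤ ENNReal.ofReal W) → 0 ≤ V →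
      WeakBound F a V → ∀ x, ‖F x‖ ≤ C' * (V ^ (1 / a) * 2 ^ ((j : ℝ) * (n / a))) := by
  -- With M the supremum of |F|, values at most `ε * M` contribute at most M / 2 to the reproducing
  -- integral and can be absorbed. The a priori bound `M₀` makes M finite; the larger values are
  -- controlled by the weak bound at level `ε * M`.
  set ε : ℝ := (2 * (C * W))⁻¹ with hε
  have hε0 : 0 < ε := by positivity
  refine ⟨(2 * C * ε ^ (-a)) ^ (1 / a), by positivity,
    fun F ω M₀ V j hF hM₀ hrep hω hWj hV hweak x => ?_⟩
  have hbdd : BddAbove (range fun x => ‖F x‖) := ⟨M₀, by rintro _ ⟨x, rfl⟩; exact hM₀ x⟩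
  set M : ℝ := ⨆ x, ‖F x‖ with hM
  have hFM : ∀ x, ‖F x‖ ≤ M := fun x => le_ciSup hbdd x
  refine (hFM x).trans ?_
  have hM0 : 0 ≤ M := (norm_nonneg _).trans (hFM x)
  rcases hM0.eq_or_lt with h0 | hMpos
  · rw [← h0]; positivity
  have hms : NullMeasurableSet {y | ε * M < ‖F y‖} :=
    nullMeasurableSet_lt aemeasurable_const hF.norm.aemeasurable
  have key : ∀ x, ‖F x‖ ≤ C * (ε * M * W + M * ((2 : ℝ) ^ j) ^ n * (V * (ε * M) ^ (-a))) := by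
    intro x
    have h1 := enorm_cv_le (f := F) hC.le hω x
    rw [hrep x] at h1
    have h2 : ∫⁻ y, ‖F y‖ₑ * ENNReal.ofReal (profile j (x - y)) ≤
        ENNReal.ofReal (ε * M * W + M * ((2 : ℝ) ^ j) ^ n * (V * (ε * M) ^ (-a))) := by
      calc ∫⁻ y, ‖F y‖ₑ * ENNReal.ofReal (profile j (x - y))
          ≤ ∫⁻ y, (ENNReal.ofReal (ε * M) * ENNReal.ofReal (profile j (x - y)) +
              ({y | ε * M < ‖F y‖}).indicator
                (fun _ => ENNReal.ofReal (M * ((2 : ℝ) ^ j) ^ n)) y) := by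
            refine lintegral_mono fun y => ?_
            rw [← ofReal_norm]
            by_cases hy : ε * M < ‖F y‖
            · rw [indicator_of_mem (by exact hy)]
              refine le_add_left ?_
              rw [← ENNReal.ofReal_mul (norm_nonneg _)]
              exact ENNReal.ofReal_le_ofReal
                (mul_le_mul (hFM y) (profile_le j _) (profile_nonneg _ _) hM0)
            · refine le_add_right ?_
              gcongr
              exact not_lt.mp hy
        _ = ENNReal.ofReal (ε * M) * (∫⁻ z : Rn n, ENNReal.ofReal (profile j z)) +
              ENNReal.ofReal (M * ((2 : ℝ) ^ j) ^ n) * distrib F (ε * M) := by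
            rw [lintegral_add_left ((measurable_profile_sub j x).const_mul _),
              lintegral_const_mul' _ _ ENNReal.ofReal_ne_top, lintegral_profile_sub,
              lintegral_indicator_const₀ hms]
            rfl
        _ ≤ ENNReal.ofReal (ε * M) * ENNReal.ofReal W +
              ENNReal.ofReal (M * ((2 : ℝ) ^ j) ^ n) *
                ENNReal.ofReal (V * (ε * M) ^ (-a)) := by
            gcongr
            exact hweak _ (by positivity)
        _ = _ := by
            rw [← ENNReal.ofReal_mul (by positivity), ← ENNReal.ofReal_mul (by positivity),
              ← ENNReal.ofReal_add (by positivity) (by positivity)]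
    have h3 := h1.trans (mul_le_mul_right h2 _)
    rwa [← ENNReal.ofReal_mul hC.le, ← ofReal_norm,
      ENNReal.ofReal_le_ofReal_iff (by positivity)] at h3
  have h4 : M ≤ C * (ε * M * W + M * ((2 : ℝ) ^ j) ^ n * (V * (ε * M) ^ (-a))) := ciSup_le key
  have h5 : C * (ε * M * W) = M / 2 := by
    rw [hε]; field_simp
  have h6 : M ^ a ≤ 2 * C * ε ^ (-a) * (V * ((2 : ℝ) ^ j) ^ n) := by
    rw [mul_add, h5, Real.mul_rpow hε0.le hM0, Real.rpow_neg hM0] at h4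
    have h7 : M * 1 ≤ M * (2 * C * ε ^ (-a) * (V * ((2 : ℝ) ^ j) ^ n) * (M ^ a)⁻¹) := by
      linarith
    have h8 := le_of_mul_le_mul_left h7 hMpos
    rwa [← div_eq_mul_inv, le_div_iff₀ (by positivity), one_mul] at h8
  have h9 := Real.rpow_le_rpow (by positivity) h6 (by positivity : 0 ≤ 1 / a)
  rw [← Real.rpow_mul hM0, mul_one_div_cancel ha.ne', Real.rpow_one,
    Real.mul_rpow (by positivity) (by positivity), Real.mul_rpow hV (by positivity),
    two_zpow_pow_rpow, mul_one_div] at h9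
  exact h9

/-- Reproduction upgrades an almost everywhere bound to an everywhere bound; this is the substitute
for Bernstein when p₂ = ∞. -/
lemma norm_le_of_ae_le {C W Y : ℝ} (hC : 0 ≤ C) (hW : 0 ≤ W) (hY : 0 ≤ Y) {F ω : Rn n → ℂ}
    {j : ℤ} (hrep : ∀ x, cv F ω x = F x) (hω : ∀ z, ‖ω z‖ ≤ C * profile j z)
    (hWj : ∫⁻ z : Rn n, ENNReal.ofReal (profile j z) ≤ ENNReal.ofReal W)
    (hF : ∀ᵐ x, ‖F x‖ ≤ Y) (x : Rn n) : ‖F x‖ ≤ C * W * Y := by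
  have h1 := enorm_cv_le (f := F) hC hω x
  rw [hrep x] at h1
  have h2 : ∫⁻ y, ‖F y‖ₑ * ENNReal.ofReal (profile j (x - y)) ≤
      ENNReal.ofReal (Y * W) := by
    calc ∫⁻ y, ‖F y‖ₑ * ENNReal.ofReal (profile j (x - y))
        ≤ ∫⁻ y, ENNReal.ofReal Y * ENNReal.ofReal (profile j (x - y)) := by
          refine lintegral_mono_ae ?_
          filter_upwards [hF] with y hy
          rw [← ofReal_norm]
          gcongr
      _ ≤ _ := by
          rw [lintegral_const_mul' _ _ ENNReal.ofReal_ne_top, lintegral_profile_sub,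
            ENNReal.ofReal_mul hY]
          gcongr
  have h3 := h1.trans (mul_le_mul_right h2 _)
  rw [← ENNReal.ofReal_mul hC, ← ofReal_norm, ENNReal.ofReal_le_ofReal_iff (by positivity)] at h3
  linarith

end Convolution

/-! ### Almost everywhere convergence of approximate identities -/

section LebesguePoints

variable {n : ℕ}

/-- On the shell where `‖2 ^ M • z‖` is about `2 ^ i`, the profile is about 2^(Mn) 2^(-i(n+1)) =
2^((M-i)n) 2^(-i). This is a normalised ball indicator with a summable weight. -/
lemma profile_le_tsum (M : ℤ) (z : Rn n) : ENNReal.ofReal (profile M z) ≤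
    ∑' i : ℕ, ENNReal.ofReal (2 ^ (n + 1) * (1 / 2) ^ i * ((2 : ℝ) ^ (M - i)) ^ n) *
      (Metric.closedBall (0 : Rn n) ((2 : ℝ) ^ (-(M - i : ℤ)))).indicator 1 z := by
  have hM : (0 : ℝ) < 2 ^ M := by positivity
  obtain ⟨N, hN⟩ := pow_unbounded_of_one_lt ‖(2 : ℝ) ^ M • z‖ (one_lt_two (α := ℝ))
  classical
  have hex : ∃ N : ℕ, ‖(2 : ℝ) ^ M • z‖ ≤ 2 ^ N := ⟨N, hN.le⟩
  refine le_trans ?_ (ENNReal.le_tsum (Nat.find hex))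
  have h1 := Nat.find_spec hex
  have hmin := fun m => Nat.find_min hex (m := m)
  set i := Nat.find hex
  have hmem : z ∈ Metric.closedBall (0 : Rn n) ((2 : ℝ) ^ (-(M - i : ℤ))) := by
    rw [mem_closedBall_zero_iff, neg_sub, zpow_sub₀ two_ne_zero, le_div_iff₀ hM, zpow_natCast]
    rwa [norm_smul, Real.norm_of_nonneg hM.le, mul_comm] at h1
  rw [indicator_of_mem hmem, Pi.one_apply, mul_one]
  apply ENNReal.ofReal_le_ofReal
  have e1 : (2 : ℝ) ^ (n + 1) * (1 / 2) ^ i * ((2 : ℝ) ^ (M - i)) ^ n =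
      ((2 : ℝ) ^ M) ^ n * (2 ^ (n + 1) * ((2 ^ i) ^ (n + 1))⁻¹) := by
    rw [zpow_sub₀ two_ne_zero, zpow_natCast, div_pow, div_pow, one_pow, pow_succ (2 ^ i : ℝ) n]
    field_simp
  rw [e1, profile]
  gcongr
  rw [← div_eq_mul_inv, ← div_pow, ← inv_pow]
  gcongr
  rw [inv_le_comm₀ (by positivity) (by positivity), inv_div]
  rcases Nat.eq_zero_or_pos i with h0 | h0
  · rw [h0, pow_zero]
    linarith [norm_nonneg ((2 : ℝ) ^ M • z)]
  · obtain ⟨k, hk⟩ := Nat.exists_eq_succ_of_ne_zero h0.ne'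
    have h2 := hmin k (by omega)
    rw [not_le] at h2
    rw [hk, pow_succ, mul_div_cancel_right₀ _ two_ne_zero]
    linarith

/-- Normalised mean oscillation of `f` around `x` over the ball of radius `2 ^ (-j)`. -/
noncomputable def osc (f : Rn n → ℂ) (x : Rn n) (j : ℤ) : ℝ≥0∞ :=
  ENNReal.ofReal (((2 : ℝ) ^ j) ^ n) *
    ∫⁻ y in Metric.closedBall x ((2 : ℝ) ^ (-j)), ‖f y - f x‖ₑ

lemma lintegral_osc_le {f : Rn n → ℂ} (hf : AEStronglyMeasurable f volume) (x : Rn n) (M : ℤ) :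
    ∫⁻ y, ‖f y - f x‖ₑ * ENNReal.ofReal (profile M (x - y)) ≤
      ∑' i : ℕ, ENNReal.ofReal (2 ^ (n + 1) * (1 / 2) ^ i) * osc f x (M - i) := by
  have hmeas : AEMeasurable (fun y => ‖f y - f x‖ₑ) volume :=
    (hf.sub aestronglyMeasurable_const).enorm
  calc ∫⁻ y, ‖f y - f x‖ₑ * ENNReal.ofReal (profile M (x - y))
      ≤ ∫⁻ y, ∑' i : ℕ, ENNReal.ofReal (2 ^ (n + 1) * (1 / 2) ^ i * ((2 : ℝ) ^ (M - i)) ^ n) *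
          (Metric.closedBall x ((2 : ℝ) ^ (-(M - i : ℤ)))).indicator
            (fun y => ‖f y - f x‖ₑ) y := by
        refine lintegral_mono fun y => ?_
        refine (mul_le_mul_right (profile_le_tsum M (x - y)) _).trans ?_
        rw [← ENNReal.tsum_mul_left]
        refine ENNReal.tsum_le_tsum fun i => ?_
        rw [mul_left_comm]
        gcongr
        by_cases hy : y ∈ Metric.closedBall x ((2 : ℝ) ^ (-(M - i : ℤ)))
        · rw [indicator_of_mem hy]
          exact mul_le_of_le_one_right' (indicator_le_self' (fun _ _ => zero_le) _)
        · rw [indicator_of_notMem, mul_zero]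
          · exact zero_le
          · rw [mem_closedBall_zero_iff]
            rwa [Metric.mem_closedBall, dist_comm, dist_eq_norm] at hy
    _ = ∑' i : ℕ, ENNReal.ofReal (2 ^ (n + 1) * (1 / 2) ^ i) * osc f x (M - i) := by
        rw [lintegral_tsum fun i =>
          ((hmeas.indicator Metric.isClosed_closedBall.measurableSet).const_mul _)]
        congr 1
        funext i
        rw [lintegral_const_mul' _ _ ENNReal.ofReal_ne_top,
          lintegral_indicator Metric.isClosed_closedBall.measurableSet, osc, ← mul_assoc,
          ← ENNReal.ofReal_mul (by positivity)]

lemma lintegral_ball_le {f : Rn n → ℂ} {D κ : ℝ} (hfD : AvgBound f D κ) (x : Rn n) (j : ℤ) :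
    ENNReal.ofReal (((2 : ℝ) ^ j) ^ n) *
      ∫⁻ y in Metric.closedBall x ((2 : ℝ) ^ (-j)), ‖f y‖ₑ ≤
      ENNReal.ofReal (2 ^ (n + 1)) * ENNReal.ofReal (D * 2 ^ ((j : ℝ) * κ)) := by
  refine le_trans ?_ (mul_le_mul_right (hfD j x) _)
  rw [← lintegral_const_mul' _ _ ENNReal.ofReal_ne_top,
    ← lintegral_const_mul' _ _ ENNReal.ofReal_ne_top]
  refine le_trans ?_ (setLIntegral_le_lintegral (Metric.closedBall x ((2 : ℝ) ^ (-j))) _)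
  refine setLIntegral_mono' Metric.isClosed_closedBall.measurableSet fun y hy => ?_
  rw [mul_comm, mul_left_comm, ← ENNReal.ofReal_mul (by positivity)]
  gcongr
  rw [profile, mul_left_comm]
  refine le_mul_of_one_le_right (by positivity) ?_
  rw [← div_eq_mul_inv, one_le_div (by positivity)]
  gcongr
  rw [Metric.mem_closedBall, dist_comm, dist_eq_norm, zpow_neg] at hy
  rw [norm_smul, Real.norm_of_nonneg (by positivity)]
  have : (2 : ℝ) ^ j * ‖x - y‖ ≤ 1 := by
    rwa [← le_inv_mul_iff₀ (by positivity), mul_one]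
  linarith

lemma locallyIntegrable_of_avgBound {f : Rn n → ℂ} {D κ : ℝ}
    (hf : AEStronglyMeasurable f volume) (hfD : AvgBound f D κ) :
    LocallyIntegrable f volume := by
  intro x
  refine ⟨Metric.closedBall x 1, Metric.closedBall_mem_nhds x one_pos, hf.restrict, ?_⟩
  have h := lintegral_ball_le hfD x 0
  simp only [zpow_zero, one_pow, ENNReal.ofReal_one, one_mul, neg_zero] at h
  exact h.trans_lt (by finiteness)

lemma osc_le {f : Rn n → ℂ} {D κ : ℝ} (hfD : AvgBound f D κ) (x : Rn n) (j : ℤ) :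
    osc f x j ≤ ENNReal.ofReal (2 ^ (n + 1)) * ENNReal.ofReal (D * 2 ^ ((j : ℝ) * κ)) +
      ‖f x‖ₑ * volume (Metric.closedBall (0 : Rn n) 1) := by
  have hv : ENNReal.ofReal (((2 : ℝ) ^ j) ^ n) *
      volume (Metric.closedBall x ((2 : ℝ) ^ (-j))) = volume (Metric.closedBall (0 : Rn n) 1) := by
    rw [Measure.addHaar_closedBall' _ _ (by positivity), finrank_euclideanSpace, Fintype.card_fin,
      ← mul_assoc, ← ENNReal.ofReal_mul (by positivity), ← mul_pow, ← zpow_add₀ two_ne_zero]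
    simp
  calc osc f x j ≤ ENNReal.ofReal (((2 : ℝ) ^ j) ^ n) *
        ∫⁻ y in Metric.closedBall x ((2 : ℝ) ^ (-j)), (‖f y‖ₑ + ‖f x‖ₑ) := by
        unfold osc
        gcongr
        exact enorm_sub_le
    _ = ENNReal.ofReal (((2 : ℝ) ^ j) ^ n) *
        (∫⁻ y in Metric.closedBall x ((2 : ℝ) ^ (-j)), ‖f y‖ₑ) +
        ‖f x‖ₑ * volume (Metric.closedBall (0 : Rn n) 1) := by
        rw [lintegral_add_right _ measurable_const, mul_add, setLIntegral_const, mul_left_comm, hv]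
    _ ≤ _ := by
        exact add_le_add (lintegral_ball_le hfD x j) le_rfl

lemma tendsto_two_zpow_atTop :
    Filter.Tendsto (fun j : ℤ => (2 : ℝ) ^ j) Filter.atTop Filter.atTop := by
  refine Filter.tendsto_atTop_mono' _ ?_ tendsto_intCast_atTop_atTop
  filter_upwards [Filter.eventually_ge_atTop 0] with j hj
  lift j to ℕ using hj
  rw [zpow_natCast, Int.cast_natCast]
  exact_mod_cast Nat.lt_two_pow_self.le

lemma ae_tendsto_osc {f : Rn n → ℂ} {D κ : ℝ}
    (hf : AEStronglyMeasurable f volume) (hfD : AvgBound f D κ) :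
    ∀ᵐ x, Filter.Tendsto (osc f x) Filter.atTop (nhds 0) := by
  have hloc := locallyIntegrable_of_avgBound hf hfD
  filter_upwards [IsUnifLocDoublingMeasure.ae_tendsto_average_norm_sub (μ := volume) hloc 1]
    with x hx
  have hδ : Filter.Tendsto (fun j : ℤ => (2 : ℝ) ^ (-j)) Filter.atTop
      (nhdsWithin 0 (Ioi 0)) := by
    refine tendsto_nhdsWithin_iff.mpr ⟨?_, Filter.Eventually.of_forall fun j => by
      simp only [mem_Ioi]; positivity⟩
    simp only [zpow_neg]
    exact tendsto_two_zpow_atTop.inv_tendsto_atTop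
  have h1 := hx (fun _ : ℤ => x) _ hδ (Filter.Eventually.of_forall fun j => by
    simp only [Metric.mem_closedBall, dist_self]; positivity)
  have h2 := ENNReal.Tendsto.mul_const (b := volume (Metric.closedBall (0 : Rn n) 1))
    (ENNReal.tendsto_ofReal h1)
    (Or.inr measure_closedBall_lt_top.ne)
  rw [ENNReal.ofReal_zero, zero_mul] at h2
  refine h2.congr fun j => ?_
  have hint : IntegrableOn (fun y => ‖f y - f x‖) (Metric.closedBall x ((2 : ℝ) ^ (-j))) := by
    refine ((hloc.integrableOn_isCompact (isCompact_closedBall _ _)).sub ?_).norm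
    exact integrableOn_const measure_closedBall_lt_top.ne
  have hpos : 0 < volume.real (Metric.closedBall x ((2 : ℝ) ^ (-j))) :=
    ENNReal.toReal_pos (Metric.measure_closedBall_pos _ _ (by positivity)).ne'
      measure_closedBall_lt_top.ne
  rw [setAverage_eq, smul_eq_mul, ENNReal.ofReal_mul (by positivity),
    ofReal_integral_eq_lintegral_ofReal hint (ae_of_all _ fun _ => norm_nonneg _),
    ENNReal.ofReal_inv_of_pos hpos, measureReal_def, ENNReal.ofReal_toReal
    measure_closedBall_lt_top.ne, Measure.addHaar_closedBall' _ _ (by positivity)]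
  simp only [ofReal_norm, finrank_euclideanSpace, Fintype.card_fin, osc]
  have hb0 : volume (Metric.closedBall (0 : Rn n) 1) ≠ 0 :=
    (Metric.measure_closedBall_pos _ _ one_pos).ne'
  have hbt : volume (Metric.closedBall (0 : Rn n) 1) ≠ ∞ := measure_closedBall_lt_top.ne
  rw [ENNReal.mul_inv (Or.inr hbt) (Or.inr hb0), mul_right_comm, mul_assoc _ (_)⁻¹ _,
    ENNReal.inv_mul_cancel hb0 hbt, mul_one, ← ENNReal.ofReal_inv_of_pos (by positivity),
    zpow_neg, inv_pow, inv_inv]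

/-- Each shell contributes an oscillation that vanishes at a Lebesgue point, with geometric weight
in the shell index; dominated convergence for the counting measure sums them. -/
lemma tendsto_lintegral_osc {f : Rn n → ℂ} {D κ : ℝ} (hD : 0 ≤ D) (hκ : 0 ≤ κ)
    (hf : AEStronglyMeasurable f volume) (hfD : AvgBound f D κ) {x : Rn n}
    (hx : Filter.Tendsto (osc f x) Filter.atTop (nhds 0)) :
    Filter.Tendsto (fun M : ℤ => ∫⁻ y, ‖f y - f x‖ₑ * ENNReal.ofReal (profile M (x - y)))
      Filter.atTop (nhds 0) := by
  obtain ⟨J, hJ⟩ : ∃ J : ℤ, ∀ j ≥ J, osc f x j ≤ 1 := by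
    have := hx.eventually (ge_mem_nhds one_pos)
    exact Filter.eventually_atTop.mp this
  -- Fine scales are bounded by the choice of J; coarser ones by the average bound at J, since `0 ≤
  -- κ` makes `2 ^ (j * κ)` nondecreasing in j.
  obtain ⟨B, hB, hoB⟩ : ∃ B : ℝ≥0∞, B < ∞ ∧ ∀ j, osc f x j ≤ B := by
    refine ⟨max 1 (ENNReal.ofReal (2 ^ (n + 1)) * ENNReal.ofReal (D * 2 ^ ((J : ℝ) * κ)) +
      ‖f x‖ₑ * volume (Metric.closedBall (0 : Rn n) 1)), ?_, fun j => ?_⟩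
    · have : volume (Metric.closedBall (0 : Rn n) 1) < ∞ := measure_closedBall_lt_top
      refine max_lt (by finiteness) (by finiteness)
    · rcases le_total J j with h | h
      · exact (hJ j h).trans (le_max_left _ _)
      · refine ((osc_le hfD x j).trans ?_).trans (le_max_right _ _)
        gcongr
        exact one_le_two
  refine tendsto_of_tendsto_of_tendsto_of_le_of_le tendsto_const_nhds ?_ (fun _ => zero_le)
    (fun M => lintegral_osc_le hf x M)
  simp only [← lintegral_count]
  rw [← lintegral_zero (μ := (Measure.count : Measure ℕ))]
  refine tendsto_lintegral_filter_of_dominated_convergence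
    (fun i => ENNReal.ofReal (2 ^ (n + 1) * (1 / 2) ^ i) * B)
    (Filter.Eventually.of_forall fun M => measurable_from_nat)
    (Filter.Eventually.of_forall fun M => ae_of_all _ fun i => by gcongr; exact hoB _) ?_
    (ae_of_all _ fun i => ?_)
  · rw [lintegral_count, ENNReal.tsum_mul_right,
      ← ENNReal.ofReal_tsum_of_nonneg (fun i => by positivity)
        ((summable_geometric_of_lt_one (by norm_num) (by norm_num)).mul_left _)]
    finiteness
  · have h1 : Filter.Tendsto (fun M : ℤ => osc f x (M - i)) Filter.atTop (nhds 0) :=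
      hx.comp (Filter.tendsto_atTop_add_const_right _ (-(i : ℤ)) Filter.tendsto_id)
    have h2 := ENNReal.Tendsto.const_mul (a := ENNReal.ofReal (2 ^ (n + 1) * (1 / 2) ^ i)) h1
      (Or.inr ENNReal.ofReal_ne_top)
    rwa [mul_zero] at h2

/-- Almost everywhere convergence of approximate identities. -/
lemma ae_tendsto_cv {f : Rn n → ℂ} {C D κ : ℝ} (hD : 0 ≤ D) (hκ : 0 ≤ κ) (hC : 0 ≤ C)
    (hf : AEStronglyMeasurable f volume) (hfD : AvgBound f D κ) {K : ℤ → Rn n → ℂ}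
    (hKc : ∀ j, Continuous (K j)) (hK : ∀ j z, ‖K j z‖ ≤ C * profile j z)
    (hKi : ∀ j, Integrable (K j)) (hK1 : ∀ j, ∫ z, K j z = 1) :
    ∀ᵐ x, Filter.Tendsto (fun j => cv f (K j) x) Filter.atTop (nhds (f x)) := by
  filter_upwards [ae_tendsto_osc hf hfD] with x hx
  have h1 := tendsto_lintegral_osc hD hκ hf hfD hx
  have h2 := ENNReal.Tendsto.const_mul (a := ENNReal.ofReal C) h1 (Or.inr ENNReal.ofReal_ne_top)
  rw [mul_zero] at h2
  rw [tendsto_iff_edist_tendsto_0]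
  refine tendsto_of_tendsto_of_tendsto_of_le_of_le tendsto_const_nhds h2 (fun _ => zero_le)
    fun M => ?_
  have e : cv f (K M) x - f x = ∫ y, (f y - f x) * K M (x - y) := by
    have h3 : ∫ y, f x * K M (x - y) = f x := by
      rw [integral_const_mul, integral_sub_left_eq_self (K M) volume x, hK1, mul_one]
    simp only [sub_mul]
    rw [integral_sub (integrable_cv hf hfD (hKc M) hC (hK M) x)
      (((hKi M).comp_sub_left x).const_mul _), h3]
    rfl
  simp only
  rw [edist_eq_enorm_sub, e]
  refine (enorm_integral_le_lintegral_enorm _).trans ?_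
  simp only [enorm_mul]
  exact lintegral_mul_kernel_le hC (hK M) x

end LebesguePoints

/-! ### Summing frequency pieces and choosing the cut-off frequency -/

section Telescoping

variable {n : ℕ}

/-- Take the largest integer J meeting the first condition; rounding down loses at most the factor
`2 ^ l` in the second. -/
lemma exists_dyadic {y κ : ℝ} (hy : 0 < y) (hκ : 0 < κ) :
    ∃ J : ℤ, (2 : ℝ) ^ ((J : ℝ) * κ) ≤ y ∧
      ∀ l : ℝ, 0 ≤ l → (2 : ℝ) ^ (-((J : ℝ) * l)) ≤ 2 ^ l * y ^ (-(l / κ)) := by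
  set z := Real.logb 2 y / κ with hz
  have hyz : y = 2 ^ (z * κ) := by
    rw [hz, div_mul_cancel₀ _ hκ.ne', Real.rpow_logb two_pos (by norm_num) hy]
  refine ⟨⌊z⌋, ?_, fun l hl => ?_⟩
  · conv_rhs => rw [hyz]
    have := Int.floor_le z
    exact Real.rpow_le_rpow_of_exponent_le one_le_two (by gcongr)
  · rw [hyz, ← Real.rpow_mul two_pos.le, ← Real.rpow_add two_pos]
    have h1 : z * κ * -(l / κ) = -(z * l) := by field_simp
    rw [h1]
    refine Real.rpow_le_rpow_of_exponent_le one_le_two ?_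
    nlinarith [Int.lt_floor_add_one z]

lemma telescope {L F : ℤ → Rn n → ℂ} (hL : ∀ j x, L (j + 1) x = L j x + F (j + 1) x)
    (J : ℤ) (x : Rn n) (N : ℕ) :
    L (J + N) x = L J x + ∑ i ∈ Finset.range N, F (J + 1 + i) x := by
  induction N with
  | zero => simp
  | succ N ih =>
    rw [Finset.sum_range_succ, ← add_assoc, ← ih]
    push_cast
    rw [← add_assoc, hL]
    congr 2
    ring

lemma norm_sub_le_of_tsum {L F : ℤ → Rn n → ℂ} {g : Rn n → ℂ}
    (hL : ∀ j x, L (j + 1) x = L j x + F (j + 1) x) {x : Rn n}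
    (hx : Filter.Tendsto (fun j => L j x) Filter.atTop (nhds (g x))) {J : ℤ} {b : ℕ → ℝ} {α : ℝ}
    (hb0 : ∀ i, 0 ≤ b i) (hb : HasSum b α) (hF : ∀ i : ℕ, ‖F (J + 1 + i) x‖ ≤ b i) :
    ‖g x - L J x‖ ≤ α := by
  have h1 : Filter.Tendsto (fun N : ℕ => ‖L (J + N) x - L J x‖) Filter.atTop
      (nhds ‖g x - L J x‖) := by
    have : Filter.Tendsto (fun N : ℕ => J + (N : ℤ)) Filter.atTop Filter.atTop :=
      Filter.tendsto_atTop_add_const_left _ _ tendsto_natCast_atTop_atTop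
    exact ((hx.comp this).sub_const _).norm
  refine le_of_tendsto h1 (Filter.Eventually.of_forall fun N => ?_)
  rw [telescope hL, add_sub_cancel_left]
  refine (norm_sum_le _ _).trans ((Finset.sum_le_sum fun i _ => hF i).trans ?_)
  exact sum_le_hasSum _ (fun i _ => hb0 i) hb

/-- The level α is divided among the pieces in geometric shares `δ * α * ρ ^ i`, which avoids any
triangle inequality in weak L^r and so allows every r > 0. The shares spend half of the decay `2 ^
(-l)`; the other half makes the measures summable with ratio τ. -/
lemma exists_weakBound_high {r l : ℝ} (hr : 0 < r) (hl : 0 < l) :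
    ∃ C : ℝ, 0 < C ∧ ∀ (g : Rn n → ℂ) (L F : ℤ → Rn n → ℂ) (E : ℝ),
      (∀ j x, L (j + 1) x = L j x + F (j + 1) x) →
      (∀ᵐ x, Filter.Tendsto (fun j => L j x) Filter.atTop (nhds (g x))) → 0 < E →
      (∀ j : ℤ, WeakBound (F j) r ((E * 2 ^ (-((j : ℝ) * l))) ^ r)) →
      ∀ J : ℤ, WeakBound (fun x => g x - L J x) r (C * (E * 2 ^ (-((J : ℝ) * l))) ^ r) := by
  set ρ : ℝ := 2 ^ (-(l / 2)) with hρ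
  have hρ0 : 0 < ρ := by positivity
  have hρ1 : ρ < 1 := Real.rpow_lt_one_of_one_lt_of_neg one_lt_two (by linarith)
  set δ : ℝ := 1 - ρ with hδ
  have hδ0 : 0 < δ := by rw [hδ]; linarith
  set τ : ℝ := 2 ^ (-(l * r / 2)) with hτ
  have hτ0 : 0 < τ := by positivity
  have hτ1 : τ < 1 := by
    have : 0 < l * r := by positivity
    exact Real.rpow_lt_one_of_one_lt_of_neg one_lt_two (by linarith)
  have hδτ : 0 < (1 - τ)⁻¹ := inv_pos.mpr (by linarith)
  refine ⟨δ ^ (-r) * 2 ^ (-(l * r)) * (1 - τ)⁻¹, by positivity,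
    fun g L F E hL hlim hE hF J α hα => ?_⟩
  have hsum : HasSum (fun i : ℕ => δ * α * ρ ^ i) α := by
    have := (hasSum_geometric_of_lt_one hρ0.le hρ1).mul_left (δ * α)
    rwa [mul_right_comm, ← hδ, mul_inv_cancel₀ hδ0.ne', one_mul] at this
  have hsub : {x | α < ‖g x - L J x‖} ≤ᵐ[volume]
      (⋃ i : ℕ, {x | δ * α * ρ ^ i < ‖F (J + 1 + i) x‖} : Set (Rn n)) := by
    filter_upwards [hlim] with x hx hxα
    by_contra hcon
    have hcon' : ∀ i : ℕ, ‖F (J + 1 + i) x‖ ≤ δ * α * ρ ^ i := by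
      intro i
      by_contra hlt
      exact hcon (mem_iUnion.mpr ⟨i, not_le.mp hlt⟩)
    have h1 := norm_sub_le_of_tsum hL hx (fun i => by positivity) hsum hcon'
    exact absurd hxα (not_lt.mpr h1)
  calc distrib (fun x => g x - L J x) α
      ≤ volume (⋃ i : ℕ, {x | δ * α * ρ ^ i < ‖F (J + 1 + i) x‖}) := measure_mono_ae hsub
    _ ≤ ∑' i : ℕ, distrib (F (J + 1 + i)) (δ * α * ρ ^ i) := measure_iUnion_le _
    _ ≤ ∑' i : ℕ, ENNReal.ofReal (δ ^ (-r) * 2 ^ (-(l * r)) *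
          ((E * 2 ^ (-((J : ℝ) * l))) ^ r * α ^ (-r)) * τ ^ i) := by
        refine ENNReal.tsum_le_tsum fun i => (hF _ _ (by positivity)).trans_eq ?_
        congr 1
        have e1 : ((2 : ℝ) ^ (-(((J + 1 + i : ℤ) : ℝ) * l))) ^ r * (ρ ^ i) ^ (-r) =
            2 ^ (-(l * r)) * (2 ^ (-((J : ℝ) * l))) ^ r * τ ^ i := by
          rw [hρ, hτ, ← Real.rpow_natCast, ← Real.rpow_natCast]
          simp only [← Real.rpow_mul two_pos.le, ← Real.rpow_add two_pos]
          congr 1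
          push_cast
          ring
        rw [Real.mul_rpow hE.le (by positivity), Real.mul_rpow hE.le (by positivity),
          Real.mul_rpow (by positivity) (by positivity), Real.mul_rpow hδ0.le hα.le]
        calc _ = E ^ r * δ ^ (-r) * α ^ (-r) *
              (((2 : ℝ) ^ (-(((J + 1 + i : ℤ) : ℝ) * l))) ^ r * (ρ ^ i) ^ (-r)) := by ring
          _ = _ := by rw [e1]; ring
    _ = _ := by
        rw [← ENNReal.ofReal_tsum_of_nonneg (fun i => by positivity)
          ((summable_geometric_of_lt_one hτ0.le hτ1).mul_left _), tsum_mul_left,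
          tsum_geometric_of_lt_one hτ0.le hτ1]
        congr 1
        ring

lemma exists_sup_high {l : ℝ} (hl : 0 < l) :
    ∃ C : ℝ, 0 < C ∧ ∀ (g : Rn n → ℂ) (L F : ℤ → Rn n → ℂ) (E : ℝ),
      (∀ j x, L (j + 1) x = L j x + F (j + 1) x) →
      (∀ᵐ x, Filter.Tendsto (fun j => L j x) Filter.atTop (nhds (g x))) → 0 < E →
      (∀ (j : ℤ) x, ‖F j x‖ ≤ E * 2 ^ (-((j : ℝ) * l))) →
      ∀ᵐ x, ∀ J : ℤ, ‖g x - L J x‖ ≤ C * (E * 2 ^ (-((J : ℝ) * l))) := by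
  set ρ : ℝ := 2 ^ (-l) with hρ
  have hρ0 : 0 < ρ := by positivity
  have hρ1 : ρ < 1 := Real.rpow_lt_one_of_one_lt_of_neg one_lt_two (by linarith)
  have hδ : 0 < (1 - ρ)⁻¹ := inv_pos.mpr (by linarith)
  refine ⟨ρ * (1 - ρ)⁻¹, by positivity, fun g L F E hL hlim hE hF => ?_⟩
  filter_upwards [hlim] with x hx J
  have hsum := (hasSum_geometric_of_lt_one hρ0.le hρ1).mul_left
    (ρ * (E * 2 ^ (-((J : ℝ) * l))))
  refine (norm_sub_le_of_tsum hL hx (fun i => by positivity) hsum fun i => ?_).trans_eq (by ring)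
  refine (hF _ _).trans_eq ?_
  rw [mul_left_comm, mul_assoc, hρ, ← Real.rpow_natCast, ← mul_assoc]
  simp only [← Real.rpow_mul two_pos.le, mul_assoc, ← Real.rpow_add two_pos]
  congr 2
  push_cast
  ring

/-- Weak-type interpolation between uniformly bounded low-frequency parts and high-frequency
parts that are small in weak `L^r`. -/
lemma exists_weakBound_combine {r l κ H : ℝ} (hr : 0 < r) (hl : 0 < l) (hκ : 0 < κ)
    (hH : 0 < H) :
    ∃ C : ℝ, 0 < C ∧ ∀ (g : Rn n → ℂ) (L : ℤ → Rn n → ℂ) (c : ℂ) (D E : ℝ), 0 < D → 0 < E →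
      (∀ (J : ℤ) x, ‖L J x - c‖ ≤ D * 2 ^ ((J : ℝ) * κ)) →
      (∀ J : ℤ, WeakBound (fun x => g x - L J x) r (H * (E * 2 ^ (-((J : ℝ) * l))) ^ r)) →
      WeakBound (fun x => g x - c) (r + l * r / κ) (C * (D ^ (l * r / κ) * E ^ r)) := by
  refine ⟨H * 2 ^ (l * r) * 2 ^ (l * r / κ) * 2 ^ r, by positivity,
    fun g L c D E hD hE hlow hhigh α hα => ?_⟩
  -- The cut-off depends on the level: it is the highest one at which the low part still stays
  -- within α / 2 of c.
  obtain ⟨J, hJ1, hJ2⟩ := exists_dyadic (y := α / (2 * D)) (by positivity) hκ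
  have h1 : distrib (fun x => g x - c) α ≤ distrib (fun x => g x - L J x) (α / 2) := by
    refine measure_mono fun x hx => ?_
    have hx' : α < ‖g x - c‖ := hx
    have h2 : ‖L J x - c‖ ≤ α / 2 := by
      refine (hlow J x).trans ((mul_le_mul_of_nonneg_left hJ1 hD.le).trans_eq ?_)
      field_simp
    have h3 : ‖g x - c‖ ≤ ‖g x - L J x‖ + ‖L J x - c‖ := by
      refine (congrArg norm ?_).trans_le (norm_add_le _ _)
      ring
    change α / 2 < ‖g x - L J x‖
    linarith
  refine h1.trans ((hhigh J _ (by positivity)).trans (ENNReal.ofReal_le_ofReal ?_))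
  have h4 := hJ2 (l * r) (by positivity)
  have e1 : ((2 : ℝ) ^ (-((J : ℝ) * l))) ^ r = 2 ^ (-((J : ℝ) * (l * r))) := by
    rw [← Real.rpow_mul two_pos.le]; congr 1; ring
  have e2 : (α / (2 * D)) ^ (-(l * r / κ)) =
      2 ^ (l * r / κ) * D ^ (l * r / κ) * α ^ (-(l * r / κ)) := by
    rw [Real.div_rpow hα.le (by positivity), Real.rpow_neg (by positivity : 0 ≤ 2 * D),
      Real.mul_rpow two_pos.le hD.le, div_inv_eq_mul]
    ring
  have e3 : (α / 2) ^ (-r) = 2 ^ r * α ^ (-r) := by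
    rw [Real.div_rpow hα.le two_pos.le, Real.rpow_neg two_pos.le, div_inv_eq_mul, mul_comm]
  have e4 : α ^ (-(r + l * r / κ)) = α ^ (-r) * α ^ (-(l * r / κ)) := by
    rw [← Real.rpow_add hα]; congr 1; ring
  rw [Real.mul_rpow hE.le (by positivity), e1, e3, e4]
  rw [e2] at h4
  calc H * (E ^ r * 2 ^ (-((J : ℝ) * (l * r)))) * (2 ^ r * α ^ (-r))
      ≤ H * (E ^ r * (2 ^ (l * r) * (2 ^ (l * r / κ) * D ^ (l * r / κ) *
          α ^ (-(l * r / κ))))) * (2 ^ r * α ^ (-r)) := by gcongr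
    _ = _ := by ring

/-- Here one cut-off serves all levels: the two bounds balance when `2 ^ (J * (κ + l))` is about `E
/ D`. -/
lemma exists_sup_combine {l κ H : ℝ} (hl : 0 < l) (hκ : 0 < κ) (hH : 0 < H) :
    ∃ C : ℝ, 0 < C ∧ ∀ (g : Rn n → ℂ) (L : ℤ → Rn n → ℂ) (D E : ℝ), 0 < D → 0 < E →
      (∀ (J : ℤ) x, ‖L J x‖ ≤ D * 2 ^ ((J : ℝ) * κ)) →
      (∀ᵐ x, ∀ J : ℤ, ‖g x - L J x‖ ≤ H * (E * 2 ^ (-((J : ℝ) * l)))) →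
      ∀ᵐ x, ‖g x‖ ≤ C * (D ^ (1 - κ / (κ + l)) * E ^ (κ / (κ + l))) := by
  refine ⟨1 + H * 2 ^ l, by positivity, fun g L D E hD hE hlow hhigh => ?_⟩
  have hκl : 0 < κ + l := by positivity
  obtain ⟨J, hJ1, hJ2⟩ := exists_dyadic (y := E / D) (by positivity) hκl
  filter_upwards [hhigh] with x hx
  have h3 : ‖g x‖ ≤ ‖g x - L J x‖ + ‖L J x‖ := by
    refine (congrArg norm ?_).trans_le (norm_add_le _ _)
    ring
  have h4 := hJ2 l hl.le
  have h5 : (2 : ℝ) ^ ((J : ℝ) * κ) ≤ (E / D) ^ (κ / (κ + l)) := by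
    have := Real.rpow_le_rpow (by positivity) hJ1 (by positivity : 0 ≤ κ / (κ + l))
    rw [← Real.rpow_mul two_pos.le] at this
    refine le_trans (le_of_eq ?_) this
    congr 1
    field_simp
  have e1 : D * (E / D) ^ (κ / (κ + l)) = D ^ (1 - κ / (κ + l)) * E ^ (κ / (κ + l)) := by
    rw [Real.div_rpow hE.le hD.le, Real.rpow_sub hD, Real.rpow_one]
    ring
  have e2 : E * (E / D) ^ (-(l / (κ + l))) = D ^ (1 - κ / (κ + l)) * E ^ (κ / (κ + l)) := by
    have : 1 - κ / (κ + l) = l / (κ + l) := by field_simp; ring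
    have h' : E ^ (κ / (κ + l)) = E * E ^ (-(l / (κ + l))) := by
      have : κ / (κ + l) = 1 + -(l / (κ + l)) := by field_simp; ring
      rw [this, Real.rpow_add hE, Real.rpow_one]
    rw [Real.div_rpow hE.le hD.le, Real.rpow_neg hD.le, div_inv_eq_mul, this, h']
    ring
  calc ‖g x‖ ≤ H * (E * 2 ^ (-((J : ℝ) * l))) + D * 2 ^ ((J : ℝ) * κ) :=
        h3.trans (add_le_add (hx J) (hlow J x))
    _ ≤ H * (E * (2 ^ l * (E / D) ^ (-(l / (κ + l))))) + D * (E / D) ^ (κ / (κ + l)) := by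
        gcongr
    _ = H * 2 ^ l * (E * (E / D) ^ (-(l / (κ + l)))) + D * (E / D) ^ (κ / (κ + l)) := by ring
    _ = _ := by rw [e1, e2]; ring

/-- Low-frequency parts whose increments decay at low frequencies and whose oscillation
vanishes in the limit converge to a constant. -/
lemma exists_const_low {κ : ℝ} (hκ : 0 < κ) :
    ∃ C : ℝ, 0 < C ∧ ∀ (L F : ℤ → Rn n → ℂ) (E : ℝ), 0 < E →
      (∀ j x, L (j + 1) x = L j x + F (j + 1) x) →
      (∀ (j : ℤ) x, ‖F j x‖ ≤ E * 2 ^ ((j : ℝ) * κ)) →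
      (∀ x, Filter.Tendsto (fun j => L j x - L j 0) Filter.atBot (nhds 0)) →
      ∃ c : ℂ, Filter.Tendsto (fun j => L j 0) Filter.atBot (nhds c) ∧
        ∀ (J : ℤ) x, ‖L J x - c‖ ≤ C * E * 2 ^ ((J : ℝ) * κ) := by
  set ρ : ℝ := 2 ^ (-κ) with hρ
  have hρ0 : 0 < ρ := by positivity
  have hρ1 : ρ < 1 := Real.rpow_lt_one_of_one_lt_of_neg one_lt_two (by linarith)
  have hδ : 0 < (1 - ρ)⁻¹ := inv_pos.mpr (by linarith)
  refine ⟨(1 - ρ)⁻¹, hδ, fun L F E hE hL hF hosc => ?_⟩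
  -- Read downwards from the top frequency, the increments form a geometric series of ratio ρ, so
  -- the bound does not involve K.
  have hstep : ∀ (K : ℤ) (N : ℕ) x, ‖L (K + N) x - L K x‖ ≤
      (1 - ρ)⁻¹ * E * 2 ^ (((K + N : ℤ) : ℝ) * κ) := by
    intro K N x
    rw [telescope hL, add_sub_cancel_left, ← Finset.sum_range_reflect]
    have hsum := (hasSum_geometric_of_lt_one hρ0.le hρ1).mul_left
      (E * 2 ^ (((K + N : ℤ) : ℝ) * κ))
    refine (norm_sum_le _ _).trans (le_trans (Finset.sum_le_sum fun i hi => ?_)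
      ((sum_le_hasSum (Finset.range N) (fun i _ => by positivity) hsum).trans_eq (by ring)))
    refine (hF _ _).trans_eq ?_
    have hi' : i < N := Finset.mem_range.mp hi
    rw [mul_assoc, hρ, ← Real.rpow_natCast, ← Real.rpow_mul two_pos.le, ← Real.rpow_add two_pos]
    congr 2
    have : ((N - 1 - i : ℕ) : ℤ) = N - 1 - i := by omega
    rw [this]
    push_cast
    ring
  have hpow : Filter.Tendsto (fun j : ℤ => (1 - ρ)⁻¹ * E * 2 ^ ((j : ℝ) * κ)) Filter.atBot
      (nhds 0) := by
    have h1 : Filter.Tendsto (fun j : ℤ => (j : ℝ) * κ) Filter.atBot Filter.atBot :=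
      (tendsto_intCast_atBot_iff.mpr Filter.tendsto_id).atBot_mul_const hκ
    have h2 := ((tendsto_rpow_atBot_of_base_gt_one 2 one_lt_two).comp h1).const_mul
      ((1 - ρ)⁻¹ * E)
    rwa [mul_zero] at h2
  have hle : ∀ (K J : ℤ) x, K ≤ J → ‖L J x - L K x‖ ≤ (1 - ρ)⁻¹ * E * 2 ^ ((J : ℝ) * κ) := by
    intro K J x h
    obtain ⟨N, rfl⟩ := Int.le.dest h
    exact hstep K N x
  have hcauchy : Cauchy (Filter.map (fun j => L j 0) Filter.atBot) := by
    rw [Metric.cauchy_iff]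
    refine ⟨inferInstance, fun ε hε => ?_⟩
    obtain ⟨J, hJ⟩ := (hpow.eventually (gt_mem_nhds (half_pos hε))).exists
    refine ⟨(fun j => L j 0) '' Iic J, Filter.image_mem_map (Filter.Iic_mem_atBot J), ?_⟩
    rintro _ ⟨a, ha, rfl⟩ _ ⟨b, hb, rfl⟩
    refine (dist_triangle_left (L a 0) (L b 0) (L J 0)).trans_lt ?_
    rw [dist_eq_norm, dist_eq_norm]
    have h1 := hle a J 0 ha
    have h2 := hle b J 0 hb
    linarith
  obtain ⟨c, hc⟩ := CompleteSpace.complete hcauchy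
  have hc' : Filter.Tendsto (fun j => L j 0) Filter.atBot (nhds c) := hc
  refine ⟨c, hc', fun J x => ?_⟩
  -- Vanishing oscillation makes the limit at x the same as the limit at the origin.
  have hcx : Filter.Tendsto (fun j => L j x) Filter.atBot (nhds c) := by
    have := (hosc x).add hc'
    simpa using this
  refine le_of_tendsto (hcx.const_sub (L J x)).norm ?_
  filter_upwards [Filter.eventually_le_atBot J] with K hK
  exact hle K J x hK

end Telescoping

/-! ### Estimates for the Littlewood-Paley pieces and low parts of a function -/

namespace LPFamily

variable {n : ℕ} (Φ : LPFamily n)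

/-- The `j`-th Littlewood-Paley piece of a function. -/
noncomputable def piece (f : Rn n → ℂ) (j : ℤ) : Rn n → ℂ := cv f (𝓕⁻ (Φ.φ j) : 𝓢(Rn n, ℂ))

/-- The low-frequency part, up to frequency `2 ^ j`, of a function. -/
noncomputable def lowPart (f : Rn n → ℂ) (j : ℤ) : Rn n → ℂ := cv f (𝓕⁻ (Φ.low j) : 𝓢(Rn n, ℂ))

lemma Δ_eq_piece {f : Rn n → ℂ} {u : S0Dual n} (hu : IsGivenBy u f) (j : ℤ) :
    Φ.Δ j u = Φ.piece f j := by
  funext x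
  refine (hu _).2.trans (integral_congr_ae (ae_of_all _ fun y => ?_))
  simp only [convKernel_apply]

lemma bumpAt_mul (j : ℤ) (ξ : Rn n) : bumpAt n (j + 1) ξ * Φ.φ j ξ = Φ.φ j ξ := by
  rcases le_or_gt ‖ξ‖ (2 ^ (j + 1)) with h | h
  · rw [bumpAt_eq_one h, one_mul]
  · rw [Φ.eq_zero_of_gt h, mul_zero]

lemma exists_lowPart_bound : ∃ C : ℝ, 0 < C ∧ ∀ (f : Rn n → ℂ) (D κ : ℝ), 0 ≤ D →
    AvgBound f D κ → ∀ j x, ‖Φ.lowPart f j x‖ ≤ C * D * 2 ^ ((j : ℝ) * κ) := by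
  obtain ⟨C, hC, h⟩ := exists_kernel_bound Φ.isVonNBounded_dil_low
  exact ⟨C, hC, fun f D κ hD hf j x => norm_cv_le hD hf hC.le (h j) x⟩

lemma lowPart_add_one {f : Rn n → ℂ} {D κ : ℝ} (hf : AEStronglyMeasurable f volume)
    (hfD : AvgBound f D κ) (j : ℤ) (x : Rn n) :
    Φ.lowPart f (j + 1) x = Φ.lowPart f j x + Φ.piece f (j + 1) x := by
  obtain ⟨C, hC, h⟩ := exists_kernel_bound Φ.isVonNBounded_dil_low
  obtain ⟨C', hC', h'⟩ := exists_kernel_bound Φ.isVonNBounded_dil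
  unfold lowPart piece cv
  rw [← integral_add
    (integrable_cv hf hfD (𝓕⁻ (Φ.low j) : 𝓢(Rn n, ℂ)).continuous hC.le (h j) x)
    (integrable_cv hf hfD (𝓕⁻ (Φ.φ (j + 1)) : 𝓢(Rn n, ℂ)).continuous hC'.le (h' (j + 1)) x)]
  refine integral_congr_ae (ae_of_all _ fun y => ?_)
  simp only
  rw [← mul_add, low_add_one, FourierTransform.fourierInv_add]
  rfl

lemma ae_tendsto_lowPart {f : Rn n → ℂ} {D κ : ℝ} (hD : 0 ≤ D) (hκ : 0 ≤ κ)
    (hf : AEStronglyMeasurable f volume) (hfD : AvgBound f D κ) :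
    ∀ᵐ x, Filter.Tendsto (fun j => Φ.lowPart f j x) Filter.atTop (nhds (f x)) := by
  obtain ⟨C, hC, h⟩ := exists_kernel_bound Φ.isVonNBounded_dil_low
  exact ae_tendsto_cv hD hκ hC.le hf hfD
    (fun j => (𝓕⁻ (Φ.low j) : 𝓢(Rn n, ℂ)).continuous) h
    (fun j => (𝓕⁻ (Φ.low j) : 𝓢(Rn n, ℂ)).integrable)
    (fun j => by rw [integral_fourierInv, low_zero])

/-- The growth exponent of the averages is 0, so the Lipschitz gain `‖2 ^ j • x‖` of the kernel
forces the difference to 0 as j → -∞. -/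
lemma tendsto_lowPart_sub {f : Rn n → ℂ} {D : ℝ} (hD : 0 ≤ D)
    (hf : AEStronglyMeasurable f volume) (hfD : AvgBound f D 0) (x : Rn n) :
    Filter.Tendsto (fun j => Φ.lowPart f j x - Φ.lowPart f j 0) Filter.atBot (nhds 0) := by
  obtain ⟨C, hC, h⟩ := exists_kernel_bound Φ.isVonNBounded_dil_low
  obtain ⟨C', hC', h'⟩ := exists_kernel_lipschitz Φ.isVonNBounded_dil_low
  have hzero : Filter.Tendsto (fun j : ℤ => ‖(2 : ℝ) ^ j • x‖) Filter.atBot (nhds 0) := by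
    have h1 : Filter.Tendsto (fun j : ℤ => (2 : ℝ) ^ j) Filter.atBot (nhds 0) := by
      have := (tendsto_two_zpow_atTop.comp Filter.tendsto_neg_atBot_atTop).inv_tendsto_atTop
      refine this.congr fun j => ?_
      simp
    have h2 := h1.mul_const ‖x‖
    rw [zero_mul] at h2
    refine h2.congr fun j => ?_
    rw [norm_smul, Real.norm_of_nonneg (by positivity)]
  have hlim := hzero.const_mul (C' * D)
  rw [mul_zero] at hlim
  refine squeeze_zero_norm' ?_ hlim
  filter_upwards [hzero.eventually (ge_mem_nhds one_pos)] with j hj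
  have e : Φ.lowPart f j x - Φ.lowPart f j 0 =
      cv f (fun z => (𝓕⁻ (Φ.low j) : 𝓢(Rn n, ℂ)) (z + x) - (𝓕⁻ (Φ.low j) : 𝓢(Rn n, ℂ)) z) 0 := by
    unfold lowPart cv
    rw [← integral_sub
      (integrable_cv hf hfD (𝓕⁻ (Φ.low j) : 𝓢(Rn n, ℂ)).continuous hC.le (h j) x)
      (integrable_cv hf hfD (𝓕⁻ (Φ.low j) : 𝓢(Rn n, ℂ)).continuous hC.le (h j) 0)]
    refine integral_congr_ae (ae_of_all _ fun y => ?_)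
    simp only
    rw [← mul_sub, zero_sub, neg_add_eq_sub]
  rw [e]
  have h3 := norm_cv_le hD hfD (by positivity : 0 ≤ C' * ‖(2 : ℝ) ^ j • x‖)
    (K := fun z => (𝓕⁻ (Φ.low j) : 𝓢(Rn n, ℂ)) (z + x) - (𝓕⁻ (Φ.low j) : 𝓢(Rn n, ℂ)) z)
    (fun z => h' j z x hj) 0
  refine h3.trans_eq ?_
  rw [mul_zero, Real.rpow_zero]
  ring

lemma exists_reproduce : ∃ C W : ℝ, 0 < C ∧ 0 < W ∧ ∃ ω : ℤ → Rn n → ℂ,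
    (∀ j z, ‖ω j z‖ ≤ C * profile j z) ∧
    (∀ j : ℤ, ∫⁻ z : Rn n, ENNReal.ofReal (profile j z) ≤ ENNReal.ofReal W) ∧
    ∀ (f : Rn n → ℂ) (D κ : ℝ), AEStronglyMeasurable f volume → 0 ≤ D → AvgBound f D κ →
      (∀ j, AEStronglyMeasurable (Φ.piece f j) volume) ∧
      (∀ j, ∃ M, ∀ x, ‖Φ.piece f j x‖ ≤ M) ∧
      ∀ j x, cv (Φ.piece f j) (ω j) x = Φ.piece f j x := by
  obtain ⟨W, hW, hWb⟩ := exists_integral_profile_le n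
  obtain ⟨C, hC, h⟩ := exists_kernel_bound (isVonNBounded_dil_bumpAt (n := n))
  obtain ⟨C', hC', h'⟩ := exists_kernel_bound Φ.isVonNBounded_dil
  refine ⟨C, W, hC, hW, fun j => (𝓕⁻ (bumpAt n (j + 1)) : 𝓢(Rn n, ℂ)), h, hWb,
    fun f D κ hf hD hfD => ⟨fun j => ?_, fun j => ?_, fun j x => ?_⟩⟩
  · exact aestronglyMeasurable_cv hf (𝓕⁻ (Φ.φ j) : 𝓢(Rn n, ℂ)).continuous
  · exact ⟨_, norm_cv_le hD hfD hC'.le (h' j)⟩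
  · exact cv_cv hf hfD (𝓕⁻ (Φ.φ j) : 𝓢(Rn n, ℂ)).continuous hC'.le (h' j)
      (𝓕⁻ (bumpAt n (j + 1)) : 𝓢(Rn n, ℂ)).continuous hC.le (h j) (hWb j)
      (fourierInv_reproduce _ _ (Φ.bumpAt_mul j)) x

lemma lorentzNorm_piece_lt {f : Rn n → ℂ} {u : S0Dual n} (hu : IsGivenBy u f) {s : ℝ}
    {p₂ : ℝ≥0∞} {B : ℝ} (hB : besovNorm Φ u s p₂ ∞ ∞ < ENNReal.ofReal B) (j : ℤ) :
    lorentzNorm (Φ.piece f j) p₂ ∞ < ENNReal.ofReal (B * 2 ^ (-((j : ℝ) * s))) := by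
  rw [besovNorm, seqNorm, if_pos rfl] at hB
  have h1 := (le_iSup (fun j : ℤ => ENNReal.ofReal ((2 : ℝ) ^ ((j : ℝ) * s)) *
    lorentzNorm (Φ.Δ j u) p₂ ∞) j).trans_lt hB
  rw [Φ.Δ_eq_piece hu] at h1
  have h2 : (0 : ℝ) < 2 ^ ((j : ℝ) * s) := by positivity
  rw [Real.rpow_neg two_pos.le, ← div_eq_mul_inv, ENNReal.ofReal_div_of_pos h2,
    ENNReal.lt_div_iff_mul_lt (Or.inl (by simpa using h2)) (Or.inl (by simp)), mul_comm]
  exact h1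

/-- Sup-norm bound for the Littlewood-Paley pieces in terms of the Besov norm. -/
lemma exists_piece_sup_bound (s : ℝ) {p₂ : ℝ≥0∞} (hp : 1 ≤ p₂) :
    ∃ C : ℝ, 1 ≤ C ∧ ∀ (f : Rn n → ℂ) (u : S0Dual n) (D κ B : ℝ),
      AEStronglyMeasurable f volume → 0 ≤ D → AvgBound f D κ → IsGivenBy u f → 0 < B →
      besovNorm Φ u s p₂ ∞ ∞ < ENNReal.ofReal B →
      ∀ j x, ‖Φ.piece f j x‖ ≤ C * B * 2 ^ ((j : ℝ) * (n * (p₂⁻¹).toReal - s)) := by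
  obtain ⟨C, W, hC, hW, ω, hω, hWb, hrep⟩ := Φ.exists_reproduce
  by_cases hpt : p₂ = ∞
  · subst hpt
    -- A constant at least 1 is kept so that its power `r - Q` can later be replaced by its power
    -- `r`.
    refine ⟨max 1 (C * W), le_max_left _ _, fun f u D κ B hf hD hfD hu hB hBu j x => ?_⟩
    obtain ⟨hm, -, hr⟩ := hrep f D κ hf hD hfD
    have h1 := norm_le_of_ae_le hC.le hW.le (by positivity) (hr j) (hω j) (hWb j)
      (ae_le_of_lorentzNorm_top_lt (Φ.lorentzNorm_piece_lt hu hBu j)) x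
    refine h1.trans ?_
    simp only [ENNReal.inv_top, ENNReal.toReal_zero, mul_zero, zero_sub, mul_neg]
    rw [mul_assoc (max 1 (C * W))]
    gcongr
    exact le_max_right _ _
  · obtain ⟨Q, hQ, rfl⟩ : ∃ Q : ℝ, 0 < Q ∧ p₂ = ENNReal.ofReal Q :=
      ⟨p₂.toReal, ENNReal.toReal_pos (by positivity) hpt, (ENNReal.ofReal_toReal hpt).symm⟩
    obtain ⟨C', hC', hb⟩ := norm_le_of_weakBound (n := n) hQ hC hW
    refine ⟨max 1 C', le_max_left _ _, fun f u D κ B hf hD hfD hu hB hBu j x => ?_⟩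
    obtain ⟨hm, hM, hr⟩ := hrep f D κ hf hD hfD
    obtain ⟨M, hM⟩ := hM j
    have h1 := hb _ (ω j) M _ j (hm j) hM (hr j) (hω j) (hWb j) (by positivity)
      (WeakBound.of_lorentzNorm_le hQ (by positivity) (Φ.lorentzNorm_piece_lt hu hBu j).le) x
    refine h1.trans ?_
    rw [← Real.rpow_mul (by positivity), mul_one_div_cancel hQ.ne', Real.rpow_one,
      ENNReal.toReal_inv, ENNReal.toReal_ofReal hQ.le, mul_assoc B, ← Real.rpow_add two_pos,
      mul_assoc (max 1 C')]
    have e : -((j : ℝ) * s) + (j : ℝ) * (n / Q) = (j : ℝ) * (n * Q⁻¹ - s) := by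
      rw [div_eq_mul_inv]; ring
    rw [e]
    gcongr
    exact le_max_right _ _

/-- Weak `L^r` bound, `r ≥ Q`, for the Littlewood-Paley pieces of `f ∈ Ḃ^{s,∞}_{Q,∞}`. -/
lemma exists_piece_weakBound (s : ℝ) {Q r : ℝ} (hQ : 1 ≤ Q) (hr : Q ≤ r) :
    ∃ C : ℝ, 0 < C ∧ ∀ (f : Rn n → ℂ) (u : S0Dual n) (D κ B : ℝ),
      AEStronglyMeasurable f volume → 0 ≤ D → AvgBound f D κ → IsGivenBy u f → 0 < B →
      besovNorm Φ u s (ENNReal.ofReal Q) ∞ ∞ < ENNReal.ofReal B →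
      ∀ j : ℤ, WeakBound (Φ.piece f j) r
        ((C * B * 2 ^ (-((j : ℝ) * (s - n / Q + n / r)))) ^ r) := by
  have hQ0 : 0 < Q := by linarith
  have hr0 : 0 < r := by linarith
  obtain ⟨C, hC, h⟩ := Φ.exists_piece_sup_bound s (p₂ := ENNReal.ofReal Q) (by simpa using hQ)
  refine ⟨C, by linarith, fun f u D κ B hf hD hfD hu hB hBu j α hα => ?_⟩
  have hC0 : 0 < C := by linarith
  have hsup := h f u D κ B hf hD hfD hu hB hBu j
  rw [ENNReal.toReal_inv, ENNReal.toReal_ofReal hQ0.le, ← div_eq_mul_inv] at hsup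
  have hweak := WeakBound.of_lorentzNorm_le hQ0 (by positivity)
    (Φ.lorentzNorm_piece_lt hu hBu j).le
  set b : ℝ := 2 ^ (-((j : ℝ) * s)) with hb
  set M : ℝ := C * B * 2 ^ ((j : ℝ) * (n / Q - s)) with hM
  have hM0 : 0 < M := by positivity
  -- Levels at or above the sup bound M carry no mass; below it, `α ^ (r - Q) ≤ M ^ (r - Q)`
  -- converts the weak L^Q bound into a weak L^r bound.
  rcases le_or_gt M α with hMα | hMα
  · have : distrib (Φ.piece f j) α = 0 :=
      distrib_eq_zero_iff.mpr (ae_of_all _ fun x => (hsup x).trans hMα)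
    rw [this]
    exact zero_le
  · refine (hweak α hα).trans (ENNReal.ofReal_le_ofReal ?_)
    have h1 : α ^ (-Q) ≤ M ^ (r - Q) * α ^ (-r) := by
      have : α ^ (-Q) = α ^ (r - Q) * α ^ (-r) := by
        rw [← Real.rpow_add hα]; congr 1; ring
      rw [this]
      have h3 : 0 ≤ r - Q := by linarith
      gcongr
    have h2 : (B * b) ^ Q * M ^ (r - Q) ≤
        (C * B * 2 ^ (-((j : ℝ) * (s - n / Q + n / r)))) ^ r := by
      have e1 : b ^ Q * ((2 : ℝ) ^ ((j : ℝ) * (n / Q - s))) ^ (r - Q) =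
          ((2 : ℝ) ^ (-((j : ℝ) * (s - n / Q + n / r)))) ^ r := by
        rw [hb, ← Real.rpow_mul two_pos.le, ← Real.rpow_mul two_pos.le,
          ← Real.rpow_mul two_pos.le, ← Real.rpow_add two_pos]
        congr 1
        field_simp
        ring
      have e2 : B ^ Q * B ^ (r - Q) = B ^ r := by
        rw [← Real.rpow_add hB]; congr 1; ring
      have h4 : C ^ (r - Q) ≤ C ^ r := Real.rpow_le_rpow_of_exponent_le hC (by linarith)
      rw [hM, Real.mul_rpow hB.le (by positivity), Real.mul_rpow (by positivity) (by positivity),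
        Real.mul_rpow hC0.le hB.le, Real.mul_rpow (by positivity) (by positivity),
        Real.mul_rpow hC0.le hB.le, ← e1, ← e2]
      calc _ = C ^ (r - Q) * (B ^ Q * B ^ (r - Q) *
            (b ^ Q * ((2 : ℝ) ^ ((j : ℝ) * (n / Q - s))) ^ (r - Q))) := by ring
        _ ≤ C ^ r * (B ^ Q * B ^ (r - Q) *
            (b ^ Q * ((2 : ℝ) ^ ((j : ℝ) * (n / Q - s))) ^ (r - Q))) := by gcongr
        _ = _ := by ring
    calc (B * b) ^ Q * α ^ (-Q) ≤ (B * b) ^ Q * (M ^ (r - Q) * α ^ (-r)) := by gcongr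
      _ = (B * b) ^ Q * M ^ (r - Q) * α ^ (-r) := by ring
      _ ≤ _ := by gcongr

end LPFamily

/-! ### Passage to the norms, and the constant at infinity -/

section Interpolation

variable {n : ℕ}

lemma lorentzNorm_one_le_of_between {a b P : ℝ} (hP : 0 < P)
    (h : (a < P ∧ P < b) ∨ (b < P ∧ P < a)) :
    ∃ C : ℝ, 0 < C ∧ ∀ (g : Rn n → ℂ) (U V : ℝ), 0 < U → 0 < V → WeakBound g a U →
      WeakBound g b V →
      lorentzNorm g (ENNReal.ofReal P) 1 ≤
        ENNReal.ofReal (C * (U ^ ((b - P) / (P * (b - a))) * V ^ ((P - a) / (P * (b - a))))) := by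
  rcases h with ⟨ha, hb⟩ | ⟨hb, ha⟩
  · exact lorentzNorm_one_le ha hb hP
  · obtain ⟨C, hC, h⟩ := lorentzNorm_one_le (n := n) hb ha hP
    refine ⟨C, hC, fun g U V hU hV hgU hgV => (h g V U hV hU hgV hgU).trans_eq ?_⟩
    have e1 : (a - P) / (P * (a - b)) = (P - a) / (P * (b - a)) := by
      rw [← neg_sub P a, ← neg_sub b a, mul_neg, neg_div_neg_eq]
    have e2 : (P - b) / (P * (a - b)) = (b - P) / (P * (b - a)) := by
      rw [← neg_sub b P, ← neg_sub b a, mul_neg, neg_div_neg_eq]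
    rw [e1, e2, mul_comm (V ^ _)]

lemma WeakBound.of_lorentzNorm_lt {f : Rn n → ℂ} (hf : AEStronglyMeasurable f volume) {P A : ℝ}
    {q : ℝ≥0∞} (hP : 1 ≤ P) (hA : 0 < A) (hq : 1 < P → q = ∞) (hq' : P = 1 → q = 1)
    (h : lorentzNorm f (ENNReal.ofReal P) q < ENNReal.ofReal A) : WeakBound f P (A ^ P) := by
  rcases hP.eq_or_lt with h1 | h1
  · subst h1
    rw [hq' rfl, ENNReal.ofReal_one, lorentzNorm_one_one hf] at h
    rw [Real.rpow_one]
    exact WeakBound.of_integral hf h.le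
  · rw [hq h1] at h
    exact WeakBound.of_lorentzNorm_le (by linarith) hA.le h.le

/-- Working with positive reals strictly above the norms avoids a separate treatment of vanishing
norms; continuity of the powers then lets the excess tend to 0. -/
lemma le_of_forall_gt_rpow {X A B : ℝ≥0∞} {C θ : ℝ} (hA : A < ∞) (hB : B < ∞) (hC : 0 < C)
    (hθ0 : 0 < θ) (hθ1 : θ < 1)
    (h : ∀ a b : ℝ, 0 < a → 0 < b → A < ENNReal.ofReal a → B < ENNReal.ofReal b →
      X ≤ ENNReal.ofReal (C * (a ^ (1 - θ) * b ^ θ))) :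
    X ≤ C.toNNReal * A ^ (1 - θ) * B ^ θ := by
  lift A to ℝ≥0 using hA.ne
  lift B to ℝ≥0 using hB.ne
  have hcont : Continuous fun ε : ℝ =>
      ENNReal.ofReal (C * (((A : ℝ) + ε) ^ (1 - θ) * ((B : ℝ) + ε) ^ θ)) := by
    refine ENNReal.continuous_ofReal.comp (continuous_const.mul (Continuous.mul ?_ ?_))
    · exact (continuous_const.add continuous_id).rpow_const fun _ => Or.inr (by linarith)
    · exact (continuous_const.add continuous_id).rpow_const fun _ => Or.inr hθ0.le
  have hlim := (hcont.tendsto 0).mono_left (nhdsWithin_le_nhds (s := Ioi 0))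
  have h1 : X ≤ ENNReal.ofReal (C * (((A : ℝ) + 0) ^ (1 - θ) * ((B : ℝ) + 0) ^ θ)) := by
    refine ge_of_tendsto hlim ?_
    filter_upwards [self_mem_nhdsWithin] with ε hε
    have hε' : 0 < ε := hε
    have hlt : ∀ A : ℝ≥0, (A : ℝ≥0∞) < ENNReal.ofReal ((A : ℝ) + ε) := by
      intro A
      rw [ENNReal.lt_ofReal_iff_toReal_lt ENNReal.coe_ne_top, ENNReal.coe_toReal]
      linarith
    exact h _ _ (by positivity) (by positivity) (hlt A) (hlt B)
  refine h1.trans_eq ?_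
  rw [add_zero, add_zero, ENNReal.ofReal_mul hC.le, ENNReal.ofReal_mul (by positivity),
    ← ENNReal.ofReal_rpow_of_nonneg A.coe_nonneg (by linarith),
    ← ENNReal.ofReal_rpow_of_nonneg B.coe_nonneg hθ0.le, ENNReal.ofReal_coe_nnreal,
    ENNReal.ofReal_coe_nnreal, mul_assoc]
  rfl

/-- The constant `c` for which `f - c` vanishes at infinity in the sense of superlevel sets. -/
noncomputable def constAtInfinity (f : Rn n → ℂ) : ℂ :=
  Classical.epsilon fun c : ℂ => ∀ ε : ℝ, 0 < ε → distrib (fun x => f x - c) ε < ∞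

/-- For two distinct admissible constants, the two superlevel sets at a third of their distance
would cover ℝⁿ, which has infinite measure as n > 0. Hence the constant depends on f alone and not
on the Littlewood-Paley family or the exponents. -/
lemma constAtInfinity_eq (hn : 0 < n) {f : Rn n → ℂ} {c : ℂ}
    (hc : ∀ ε : ℝ, 0 < ε → distrib (fun x => f x - c) ε < ∞) : constAtInfinity f = c := by
  have hc' : ∀ ε : ℝ, 0 < ε → distrib (fun x => f x - constAtInfinity f) ε < ∞ :=
    Classical.epsilon_spec (p := fun c : ℂ => ∀ ε : ℝ, 0 < ε →
      distrib (fun x => f x - c) ε < ∞) ⟨c, hc⟩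
  by_contra hne
  set d := constAtInfinity f
  have hpos : 0 < ‖d - c‖ := norm_pos_iff.mpr (sub_ne_zero.mpr hne)
  have hcover : (univ : Set (Rn n)) ⊆ {x | ‖d - c‖ / 3 < ‖f x - c‖} ∪
      {x | ‖d - c‖ / 3 < ‖f x - d‖} := by
    intro x _
    by_contra hx
    rw [mem_union, not_or] at hx
    have h1 : ‖f x - c‖ ≤ ‖d - c‖ / 3 := not_lt.mp hx.1
    have h2 : ‖f x - d‖ ≤ ‖d - c‖ / 3 := not_lt.mp hx.2
    have h3 : ‖d - c‖ ≤ ‖f x - c‖ + ‖f x - d‖ := by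
      refine (congrArg norm ?_).trans_le (norm_sub_le _ _)
      ring
    linarith
  have h1 := (measure_mono hcover).trans (measure_union_le (μ := volume) _ _)
  have : Nonempty (Fin n) := ⟨⟨0, hn⟩⟩
  rw [measure_univ_of_isAddLeftInvariant] at h1
  exact absurd (ENNReal.add_lt_top.mpr ⟨hc _ (by positivity), hc' _ (by positivity)⟩)
    (not_lt.mpr h1)

end Interpolation

/-! ### The three cases of the inequality -/

namespace LPFamily

variable {n : ℕ} (Φ : LPFamily n)

/-- The `L^∞` estimate in the case of negative differential dimension. -/
lemma exists_ae_bound (hn : 0 < n) {s P₁ : ℝ} {p₂ q₁ : ℝ≥0∞} (hP₁ : 1 ≤ P₁) (hp₂ : 1 ≤ p₂)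
    (hq : 1 < P₁ → q₁ = ∞) (hq' : P₁ = 1 → q₁ = 1) (hσ : (p₂⁻¹).toReal - s / n < 0) :
    ∃ C : ℝ, 0 < C ∧ ∀ (f : Rn n → ℂ) (u : S0Dual n) (A B : ℝ),
      AEStronglyMeasurable f volume → IsGivenBy u f → 0 < A → 0 < B →
      lorentzNorm f (ENNReal.ofReal P₁) q₁ < ENNReal.ofReal A →
      besovNorm Φ u s p₂ ∞ ∞ < ENNReal.ofReal B →
      ∀ᵐ x, ‖f x‖ ≤ C * (A ^ (1 - P₁⁻¹ / (P₁⁻¹ - ((p₂⁻¹).toReal - s / n))) *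
        B ^ (P₁⁻¹ / (P₁⁻¹ - ((p₂⁻¹).toReal - s / n)))) := by
  have hP0 : 0 < P₁ := by linarith
  have hn' : (0 : ℝ) < n := by exact_mod_cast hn
  set σ := (p₂⁻¹).toReal - s / n with hσd
  have hl : 0 < -(n * σ) := by nlinarith
  have hκ : 0 < n * P₁⁻¹ := by positivity
  obtain ⟨C₁, hC₁, havg⟩ := exists_avgBound (n := n) (p₁ := ENNReal.ofReal P₁) (q₁ := q₁)
    (by simpa using hP₁) (fun h => hq (by simpa using h)) (fun h => hq' (by simpa using h))
  obtain ⟨C₂, hC₂, hlow⟩ := Φ.exists_lowPart_bound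
  obtain ⟨C₃, hC₃, hpiece⟩ := Φ.exists_piece_sup_bound s hp₂
  obtain ⟨H, hH, hhigh⟩ := exists_sup_high (n := n) hl
  obtain ⟨C₄, hC₄, hcomb⟩ := exists_sup_combine (n := n) hl hκ hH
  set θ₀ := P₁⁻¹ / (P₁⁻¹ - σ)
  have hC30 : 0 < C₃ := by linarith
  refine ⟨C₄ * ((C₂ * C₁) ^ (1 - θ₀) * C₃ ^ θ₀), by positivity,
    fun f u A B hf hu hA hB hfA hBu => ?_⟩
  have hfD := havg f A hf hA hfA
  rw [ENNReal.toReal_inv, ENNReal.toReal_ofReal hP0.le] at hfD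
  have hD : 0 ≤ C₁ * A := by positivity
  have hsup := hpiece f u _ _ B hf hD hfD hu hB hBu
  have h1 := hhigh f (Φ.lowPart f) (Φ.piece f) (C₃ * B) (Φ.lowPart_add_one hf hfD)
    (Φ.ae_tendsto_lowPart hD hκ.le hf hfD) (by positivity) (fun j x => by
      refine (hsup j x).trans_eq ?_
      congr 2
      rw [hσd]
      field_simp)
  have h2 := hcomb f (Φ.lowPart f) (C₂ * (C₁ * A)) (C₃ * B) (by positivity) (by positivity)
    (hlow f _ _ hD hfD) h1
  have e : n * P₁⁻¹ / (n * P₁⁻¹ + -(n * σ)) = θ₀ := by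
    rw [← sub_eq_add_neg, ← mul_sub, mul_div_mul_left _ _ hn'.ne']
  filter_upwards [h2] with x hx
  rw [e, ← mul_assoc C₂, Real.mul_rpow (by positivity) hA.le, Real.mul_rpow hC30.le hB.le] at hx
  refine hx.trans_eq ?_
  ring

/-- The case of negative differential dimension. -/
lemma exists_bound_of_neg (hn : 0 < n) {s P₁ θ : ℝ} {p p₂ q q₁ : ℝ≥0∞} (hp : 1 < p)
    (hP₁ : 1 ≤ P₁) (hp₂ : 1 ≤ p₂) (hθ0 : 0 < θ)
    (hscale : (p⁻¹).toReal = (1 - θ) * P₁⁻¹ + θ * ((p₂⁻¹).toReal - s / n))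
    (hqp : p < ∞ → q = 1) (hqp' : p = ∞ → q = ∞)
    (hq : 1 < P₁ → q₁ = ∞) (hq' : P₁ = 1 → q₁ = 1) (hσ : (p₂⁻¹).toReal - s / n < 0) :
    ∃ C : ℝ, 0 < C ∧ ∀ (f : Rn n → ℂ) (u : S0Dual n) (A B : ℝ),
      AEStronglyMeasurable f volume → IsGivenBy u f → 0 < A → 0 < B →
      lorentzNorm f (ENNReal.ofReal P₁) q₁ < ENNReal.ofReal A →
      besovNorm Φ u s p₂ ∞ ∞ < ENNReal.ofReal B →
      lorentzNorm f p q ≤ ENNReal.ofReal (C * (A ^ (1 - θ) * B ^ θ)) := by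
  obtain ⟨C, hC, h⟩ := Φ.exists_ae_bound hn hP₁ hp₂ hq hq' hσ
  set σ := (p₂⁻¹).toReal - s / n
  have hP0 : 0 < P₁ := by linarith
  have hi : 0 < P₁⁻¹ := by positivity
  have hne : 0 < P₁⁻¹ - σ := by linarith
  set θ₀ := P₁⁻¹ / (P₁⁻¹ - σ) with hθ₀
  by_cases hpt : p = ∞
  · subst hpt
    rw [hqp' rfl]
    rw [ENNReal.inv_top, ENNReal.toReal_zero] at hscale
    -- For p = ∞ the scaling relation reads (1 - θ)/P₁ + θσ = 0, which determines θ.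
    have e : θ₀ = θ := by
      rw [hθ₀, div_eq_iff hne.ne']; linarith
    rw [e] at h
    exact ⟨C, hC, fun f u A B hf hu hA hB hfA hBu =>
      lorentzNorm_top_le (by positivity) (h f u A B hf hu hA hB hfA hBu)⟩
  · rw [hqp (lt_top_iff_ne_top.mpr hpt)]
    obtain ⟨P, hP, rfl⟩ : ∃ P : ℝ, 0 < P ∧ p = ENNReal.ofReal P :=
      ⟨p.toReal, ENNReal.toReal_pos (by positivity) hpt, (ENNReal.ofReal_toReal hpt).symm⟩
    rw [ENNReal.toReal_inv, ENNReal.toReal_ofReal hP.le] at hscale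
    have hlt : P₁ < P := by
      rw [← inv_lt_inv₀ hP hP0]
      nlinarith
    -- For finite p, interpolate the sup bound with the weak L^{P₁} bound.
    obtain ⟨C', hC', h'⟩ := lorentzNorm_one_le_of_top (n := n) hlt hP
    refine ⟨C' * C ^ (1 - P₁ / P), by positivity, fun f u A B hf hu hA hB hfA hBu => ?_⟩
    refine (h' f (A ^ P₁) _ (by positivity) (by positivity)
      (WeakBound.of_lorentzNorm_lt hf hP₁ hA hq hq' hfA)
      (h f u A B hf hu hA hB hfA hBu)).trans_eq ?_
    have e1 : θ₀ * (1 - P₁ / P) = θ := by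
      have h3 : θ * (P₁⁻¹ - σ) = P₁⁻¹ - P⁻¹ := by linarith
      have h4 : θ = (P₁⁻¹ - P⁻¹) / (P₁⁻¹ - σ) := by rw [eq_div_iff hne.ne', h3]
      rw [hθ₀, h4]
      field_simp
    have e2 : P₁ * (1 / P) + (1 - θ₀) * (1 - P₁ / P) = 1 - θ := by
      rw [← e1]; ring
    rw [Real.mul_rpow hC.le (by positivity), Real.mul_rpow (by positivity) (by positivity),
      ← Real.rpow_mul hA.le, ← Real.rpow_mul hA.le, ← Real.rpow_mul hB.le, e1, ← e2,
      Real.rpow_add hA]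
    congr 1
    ring

/-- The case of finite `p₁` and nonnegative differential dimension. -/
lemma exists_bound_of_nonneg (hn : 0 < n) {s P P₁ Q θ : ℝ} {q₁ : ℝ≥0∞} (hP : 1 < P)
    (hs : 0 < s) (hP₁ : 1 ≤ P₁) (hQ : 1 ≤ Q) (hθ0 : 0 < θ) (hθ1 : θ < 1)
    (hscale : P⁻¹ = (1 - θ) * P₁⁻¹ + θ * (Q⁻¹ - s / n)) (hne : P₁⁻¹ ≠ Q⁻¹ - s / n)
    (hq : 1 < P₁ → q₁ = ∞) (hq' : P₁ = 1 → q₁ = 1) (hσ : 0 ≤ Q⁻¹ - s / n) :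
    ∃ C : ℝ, 0 < C ∧ ∀ (f : Rn n → ℂ) (u : S0Dual n) (A B : ℝ),
      AEStronglyMeasurable f volume → IsGivenBy u f → 0 < A → 0 < B →
      lorentzNorm f (ENNReal.ofReal P₁) q₁ < ENNReal.ofReal A →
      besovNorm Φ u s (ENNReal.ofReal Q) ∞ ∞ < ENNReal.ofReal B →
      lorentzNorm f (ENNReal.ofReal P) 1 ≤ ENNReal.ofReal (C * (A ^ (1 - θ) * B ^ θ)) := by
  have hP0 : 0 < P := by linarith
  have hP₁0 : 0 < P₁ := by linarith
  have hQ0 : 0 < Q := by linarith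
  have hn' : (0 : ℝ) < n := by exact_mod_cast hn
  set σ := Q⁻¹ - s / n with hσd
  have hsn : 0 < s / n := by positivity
  -- `Q < r` allows the weak L^r bound on pieces, `σ * r < 1` makes it decay, and `θ * P < r` will
  -- put P between P₁ and m. They are compatible since θσ < 1/P by scaling and σ < 1/Q because s >
  -- 0.
  obtain ⟨r, hr1, hr2⟩ : ∃ r, max (θ * P) Q < r ∧ σ * r < 1 := by
    rcases hσ.eq_or_lt with h0 | h0
    · exact ⟨max (θ * P) Q + 1, lt_add_one _, by rw [← h0, zero_mul]; exact one_pos⟩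
    · have h1 : max (θ * P) Q < σ⁻¹ := by
        refine max_lt ?_ ?_
        · have h2 : θ * σ < P⁻¹ := by
            rw [hscale]
            exact lt_add_of_pos_left _ (mul_pos (by linarith) (by positivity))
          have h3 := mul_lt_mul_of_pos_right h2 hP0
          rw [inv_mul_cancel₀ hP0.ne'] at h3
          rw [← one_div, lt_div_iff₀ h0]
          linarith
        · rw [lt_inv_comm₀ hQ0 h0]
          linarith
      obtain ⟨r, h2, h3⟩ := exists_between h1
      refine ⟨r, h2, ?_⟩
      rwa [← lt_inv_mul_iff₀ h0, mul_one]
  have hrθ : θ * P < r := (le_max_left _ _).trans_lt hr1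
  have hrQ : Q ≤ r := ((le_max_right _ _).trans_lt hr1).le
  have hr0 : 0 < r := by linarith
  set l : ℝ := s - n / Q + n / r with hl
  have hl' : l = n * (r⁻¹ - σ) := by rw [hl, hσd]; field_simp; ring
  have hl0 : 0 < l := by
    rw [hl']
    have : σ < r⁻¹ := by rwa [← one_div, lt_div_iff₀ hr0]
    exact mul_pos hn' (by linarith)
  set κ : ℝ := n * P₁⁻¹ with hκ
  have hκ0 : 0 < κ := by positivity
  have hlr : l * r / κ = P₁ * (1 - σ * r) := by
    rw [hl', hκ]; field_simp
  set m : ℝ := r + l * r / κ with hm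
  have hPσ : P - P₁ = θ * P * (1 - σ * P₁) := by
    have h1 : P * P₁ * P⁻¹ = P * P₁ * ((1 - θ) * P₁⁻¹ + θ * σ) := by rw [hscale]
    have h2 : P * P₁ * P⁻¹ = P₁ := by field_simp
    have h3 : P * P₁ * ((1 - θ) * P₁⁻¹ + θ * σ) = P * (1 - θ) + P * P₁ * θ * σ := by
      field_simp
    rw [h2, h3] at h1
    linarith
  have hmP₁ : m - P₁ = r * (1 - σ * P₁) := by rw [hm, hlr]; ring
  have hne' : 1 - σ * P₁ ≠ 0 := by
    intro h0
    apply hne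
    field_simp
    linarith
  -- `P - P₁` and `m - P` are positive multiples of the same nonzero number `1 - σ * P₁`, so P lies
  -- strictly between, in an order given by its sign.
  have hbetween : (P₁ < P ∧ P < m) ∨ (m < P ∧ P < P₁) := by
    have hmP : m - P = (r - θ * P) * (1 - σ * P₁) := by linarith
    have hθP : 0 < θ * P := by positivity
    have hrr : 0 < r - θ * P := by linarith
    rcases lt_or_gt_of_ne hne' with h0 | h0
    · right
      constructor <;> nlinarith
    · left
      constructor <;> nlinarith
  obtain ⟨C₁, hC₁, havg⟩ := exists_avgBound (n := n) (p₁ := ENNReal.ofReal P₁) (q₁ := q₁)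
    (by simpa using hP₁) (fun h => hq (by simpa using h)) (fun h => hq' (by simpa using h))
  obtain ⟨C₂, hC₂, hlow⟩ := Φ.exists_lowPart_bound
  obtain ⟨C₃, hC₃, hpiece⟩ := Φ.exists_piece_weakBound s hQ hrQ
  obtain ⟨H, hH, hhigh⟩ := exists_weakBound_high (n := n) hr0 hl0
  obtain ⟨C₄, hC₄, hcomb⟩ := exists_weakBound_combine (n := n) hr0 hl0 hκ0 hH
  obtain ⟨C₅, hC₅, hint⟩ := lorentzNorm_one_le_of_between (n := n) hP0 hbetween
  refine ⟨C₅ * (C₄ * ((C₂ * C₁) ^ (l * r / κ) * C₃ ^ r)) ^ ((P - P₁) / (P * (m - P₁))),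
    by positivity, fun f u A B hf hu hA hB hfA hBu => ?_⟩
  have hfD := havg f A hf hA hfA
  rw [ENNReal.toReal_inv, ENNReal.toReal_ofReal hP₁0.le] at hfD
  have hD : 0 ≤ C₁ * A := by positivity
  have h1 := hhigh f (Φ.lowPart f) (Φ.piece f) (C₃ * B) (Φ.lowPart_add_one hf hfD)
    (Φ.ae_tendsto_lowPart hD hκ0.le hf hfD) (by positivity)
    (hpiece f u _ _ B hf hD hfD hu hB hBu)
  have h2 := hcomb f (Φ.lowPart f) 0 (C₂ * (C₁ * A)) (C₃ * B) (by positivity) (by positivity)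
    (fun J x => by rw [sub_zero]; exact hlow f _ _ hD hfD J x) h1
  simp only [sub_zero] at h2
  refine (hint f (A ^ P₁) _ (by positivity) (by positivity)
    (WeakBound.of_lorentzNorm_lt hf hP₁ hA hq hq' hfA) h2).trans_eq ?_
  set η := (P - P₁) / (P * (m - P₁)) with hη
  have e1 : r * η = θ := by
    rw [hη, hmP₁, hPσ]
    field_simp
  have e2 : P₁ * ((m - P) / (P * (m - P₁))) + l * r / κ * η = 1 - θ := by
    have h5 : l * r / κ = m - r := by rw [hm]; ring
    have h6 : m - P₁ ≠ 0 := by rw [hmP₁]; exact mul_ne_zero hr0.ne' hne'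
    rw [← e1, h5, hη]
    field_simp
    ring
  rw [← mul_assoc C₂, Real.mul_rpow (by positivity) hA.le, Real.mul_rpow hC₃.le hB.le]
  have e3 : C₄ * ((C₂ * C₁) ^ (l * r / κ) * A ^ (l * r / κ) * (C₃ ^ r * B ^ r)) =
      C₄ * ((C₂ * C₁) ^ (l * r / κ) * C₃ ^ r) * (A ^ (l * r / κ) * B ^ r) := by ring
  rw [e3, Real.mul_rpow (by positivity) (by positivity),
    Real.mul_rpow (by positivity : 0 ≤ A ^ (l * r / κ)) (by positivity),
    ← Real.rpow_mul hA.le, ← Real.rpow_mul hA.le, ← Real.rpow_mul hB.le, e1, ← e2,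
    Real.rpow_add hA]
  congr 1
  ring

/-- The case `p₁ = ∞`, where a constant has to be subtracted. -/
lemma exists_bound_of_top (hn : 0 < n) {s P Q θ : ℝ} (hs : 0 < s) (hP : 1 < P) (hQ : 1 ≤ Q)
    (hθ0 : 0 < θ) (hθ1 : θ < 1) (hscale : P⁻¹ = θ * (Q⁻¹ - s / n)) :
    ∃ C : ℝ, 0 < C ∧ ∀ (f : Rn n → ℂ) (u : S0Dual n) (A B : ℝ),
      AEStronglyMeasurable f volume → IsGivenBy u f → 0 < A → 0 < B →
      lorentzNorm f ∞ ∞ < ENNReal.ofReal A →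
      besovNorm Φ u s (ENNReal.ofReal Q) ∞ ∞ < ENNReal.ofReal B →
      lorentzNorm (fun x => f x - constAtInfinity f) (ENNReal.ofReal P) 1 ≤
        ENNReal.ofReal (C * (A ^ (1 - θ) * B ^ θ)) := by
  have hP0 : 0 < P := by linarith
  have hQ0 : 0 < Q := by linarith
  have hn' : (0 : ℝ) < n := by exact_mod_cast hn
  set σ := Q⁻¹ - s / n with hσd
  have hσ : 0 < σ := by
    have : 0 < θ * σ := by rw [← hscale]; positivity
    exact pos_of_mul_pos_right this hθ0.le
  have hκ : 0 < n * σ := by positivity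
  -- The weak exponent obtained from r = Q, l = s and κ = nσ. Low and high parts are now both
  -- measured by B, so A enters only through the sup bound.
  have hm : Q + s * Q / (n * σ) = σ⁻¹ := by
    have : n * σ = n * Q⁻¹ - s := by rw [hσd]; field_simp
    have h2 : s = n * Q⁻¹ - n * σ := by linarith
    rw [h2]
    field_simp
    ring
  have hlt : σ⁻¹ < P := by
    rw [inv_lt_comm₀ hσ hP0, hscale]
    nlinarith
  obtain ⟨C₁, hC₁, havg⟩ := exists_avgBound (n := n) (p₁ := ∞) (q₁ := ∞)
    (by simp) (fun _ => rfl) (fun h => by simp at h)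
  obtain ⟨C₂, hC₂, hlow⟩ := Φ.exists_lowPart_bound
  obtain ⟨C₃, hC₃, hpiece⟩ := Φ.exists_piece_weakBound s hQ le_rfl
  obtain ⟨C₃', hC₃', hpiece'⟩ := Φ.exists_piece_sup_bound s (p₂ := ENNReal.ofReal Q)
    (by simpa using hQ)
  have hC₃'0 : 0 < C₃' := by linarith
  obtain ⟨C₆, hC₆, hconst⟩ := exists_const_low (n := n) hκ
  obtain ⟨H, hH, hhigh⟩ := exists_weakBound_high (n := n) hQ0 hs
  obtain ⟨C₄, hC₄, hcomb⟩ := exists_weakBound_combine (n := n) hQ0 hs hκ hH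
  obtain ⟨C₅, hC₅, hint⟩ := lorentzNorm_one_le_of_top (n := n) hlt hP0
  refine ⟨C₅ * ((C₄ * ((C₆ * C₃') ^ (s * Q / (n * σ)) * C₃ ^ Q)) ^ (1 / P) *
    (1 + C₂ * C₁) ^ (1 - θ)), by positivity, fun f u A B hf hu hA hB hfA hBu => ?_⟩
  have hfD := havg f A hf hA hfA
  rw [ENNReal.inv_top, ENNReal.toReal_zero, mul_zero] at hfD
  have hD : 0 ≤ C₁ * A := by positivity
  obtain ⟨c, hc, hlc⟩ := hconst (Φ.lowPart f) (Φ.piece f) (C₃' * B) (by positivity)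
    (Φ.lowPart_add_one hf hfD) (fun j x => by
      refine (hpiece' f u _ _ B hf hD hfD hu hB hBu j x).trans_eq ?_
      rw [ENNReal.toReal_inv, ENNReal.toReal_ofReal hQ0.le]
      congr 2
      rw [hσd]
      field_simp) (Φ.tendsto_lowPart_sub hD hf hfD)
  have hcn : ‖c‖ ≤ C₂ * C₁ * A := by
    refine le_of_tendsto hc.norm (Filter.Eventually.of_forall fun j => ?_)
    refine (hlow f _ _ hD hfD j 0).trans_eq ?_
    rw [mul_zero, Real.rpow_zero]
    ring
  have h1 := hhigh f (Φ.lowPart f) (Φ.piece f) (C₃ * B) (Φ.lowPart_add_one hf hfD)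
    (Φ.ae_tendsto_lowPart hD le_rfl hf hfD) (by positivity) (fun j => by
      have := hpiece f u _ _ B hf hD hfD hu hB hBu j
      rwa [sub_add_cancel] at this)
  have h2 := hcomb f (Φ.lowPart f) c (C₆ * (C₃' * B)) (C₃ * B) (by positivity) (by positivity)
    hlc h1
  rw [hm] at h2
  -- The weak bound makes all superlevel sets of f - c finite in measure, which identifies the
  -- low-frequency limit c with the intrinsic constant.
  have hcst : constAtInfinity f = c := constAtInfinity_eq hn fun ε hε =>
    (h2 ε hε).trans_lt ENNReal.ofReal_lt_top
  rw [hcst]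
  have hY : ∀ᵐ x, ‖f x - c‖ ≤ (1 + C₂ * C₁) * A := by
    filter_upwards [ae_le_of_lorentzNorm_top_lt hfA] with x hx
    refine (norm_sub_le _ _).trans ?_
    linarith
  refine (hint _ _ _ (by positivity) (by positivity) h2 hY).trans_eq ?_
  have e1 : σ⁻¹ * (1 / P) = θ := by
    rw [one_div, hscale]
    field_simp
  have e2 : σ⁻¹ / P = θ := by rw [← e1]; ring
  rw [← mul_assoc C₆, Real.mul_rpow (by positivity) hB.le, Real.mul_rpow hC₃.le hB.le, e2,
    Real.mul_rpow (by positivity) hA.le]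
  have e3 : C₄ * ((C₆ * C₃') ^ (s * Q / (n * σ)) * B ^ (s * Q / (n * σ)) * (C₃ ^ Q * B ^ Q)) =
      C₄ * ((C₆ * C₃') ^ (s * Q / (n * σ)) * C₃ ^ Q) * B ^ σ⁻¹ := by
    rw [← hm, Real.rpow_add hB]; ring
  rw [e3, Real.mul_rpow (by positivity) (by positivity), ← Real.rpow_mul hB.le, e1]
  congr 1
  ring

end LPFamily

end LorentzGN

/-! ### Reduction of the theorem to the three cases -/

theorem theorem5p12 (n : ℕ) (hn : 0 < n) :
    -- the constant `c_{p₁}(f)`, which depends on `p₁` and `f` only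
    ∃ c : ℝ≥0∞ → (LorentzGN.Rn n → ℂ) → ℂ,
      (∀ (p₁ : ℝ≥0∞) (f : LorentzGN.Rn n → ℂ), p₁ < ∞ → c p₁ f = 0) ∧
      ∀ (Φ : LorentzGN.LPFamily n) (s θ : ℝ) (p p₁ p₂ q q₁ : ℝ≥0∞),
        0 < s → 1 < p → 1 ≤ p₁ → 1 ≤ p₂ → 0 < θ → θ < 1 →
        (p⁻¹).toReal = (1 - θ) * (p₁⁻¹).toReal + θ * ((p₂⁻¹).toReal - s / n) →
        (p₁⁻¹).toReal ≠ (p₂⁻¹).toReal - s / n →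
        (p < ∞ → q = 1) → (p = ∞ → q = ∞) →
        (1 < p₁ → q₁ = ∞) → (p₁ = 1 → q₁ = 1) →
        ∃ C : ℝ≥0, ∀ (f : LorentzGN.Rn n → ℂ) (u : LorentzGN.S0Dual n),
          LorentzGN.MemLorentz f p₁ q₁ →
          LorentzGN.IsGivenBy u f →
          LorentzGN.MemBesov Φ u s p₂ ∞ ∞ →
          LorentzGN.lorentzNorm (fun x => f x - c p₁ f) p q ≤
            C * LorentzGN.lorentzNorm f p₁ q₁ ^ (1 - θ) *
              LorentzGN.besovNorm Φ u s p₂ ∞ ∞ ^ θ := by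
  classical
  refine ⟨fun p₁ f => if p₁ < ∞ then 0 else LorentzGN.constAtInfinity f,
    fun p₁ f h => if_pos h, ?_⟩
  intro Φ s θ p p₁ p₂ q q₁ hs hp hp₁ hp₂ hθ0 hθ1 hscale hne hq hq' hq₁ hq₁'
  have hn' : (0 : ℝ) < n := by exact_mod_cast hn
  suffices h : ∃ C : ℝ, 0 < C ∧ ∀ (f : LorentzGN.Rn n → ℂ) (u : LorentzGN.S0Dual n) (A B : ℝ),
      AEStronglyMeasurable f volume → LorentzGN.IsGivenBy u f → 0 < A → 0 < B →
      LorentzGN.lorentzNorm f p₁ q₁ < ENNReal.ofReal A →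
      LorentzGN.besovNorm Φ u s p₂ ∞ ∞ < ENNReal.ofReal B →
      LorentzGN.lorentzNorm (fun x => f x - if p₁ < ∞ then 0 else LorentzGN.constAtInfinity f) p q ≤
        ENNReal.ofReal (C * (A ^ (1 - θ) * B ^ θ)) by
    obtain ⟨C, hC, h⟩ := h
    exact ⟨C.toNNReal, fun f u hf hu hB => LorentzGN.le_of_forall_gt_rpow hf.2 hB hC hθ0 hθ1
      fun a b ha hb hfa hBb => h f u a b hf.1 hu ha hb hfa hBb⟩
  have hreal : ∀ r : ℝ≥0∞, 1 ≤ r → r ≠ ∞ → ∃ R : ℝ, 1 ≤ R ∧ r = ENNReal.ofReal R := by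
    intro r hr hrt
    refine ⟨r.toReal, ?_, (ENNReal.ofReal_toReal hrt).symm⟩
    rwa [← ENNReal.ofReal_le_iff_le_toReal hrt, ENNReal.ofReal_one]
  have hinv : ∀ R : ℝ, 1 ≤ R → ((ENNReal.ofReal R)⁻¹).toReal = R⁻¹ := fun R hR => by
    rw [ENNReal.toReal_inv, ENNReal.toReal_ofReal (by linarith)]
  -- Since s > 0, an infinite p₂ occurs only when the differential dimension σ is negative.
  have hp₂t : 0 ≤ (p₂⁻¹).toReal - s / n → p₂ ≠ ∞ := by
    rintro h rfl
    rw [ENNReal.inv_top, ENNReal.toReal_zero] at h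
    have : 0 < s / n := by positivity
    linarith
  have hpt : 0 < (p⁻¹).toReal → p ≠ ∞ := by
    rintro h rfl
    simp at h
  by_cases hp₁t : p₁ = ∞
  · subst hp₁t
    rw [hq₁ (by simp)]
    simp only [lt_self_iff_false, if_false]
    rw [ENNReal.inv_top, ENNReal.toReal_zero, mul_zero, zero_add] at hscale
    rw [ENNReal.inv_top, ENNReal.toReal_zero] at hne
    -- For p₁ = ∞ scaling reads 1/p = θσ, so σ ≥ 0; the exclusion 1/p₁ ≠ σ makes it positive, and p
    -- is then finite.
    have h0 : 0 ≤ (p₂⁻¹).toReal - s / n := by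
      have : 0 ≤ θ * ((p₂⁻¹).toReal - s / n) := hscale ▸ ENNReal.toReal_nonneg
      exact nonneg_of_mul_nonneg_right this hθ0
    have hpt' : p ≠ ∞ := hpt (by
      rw [hscale]
      exact mul_pos hθ0 (lt_of_le_of_ne h0 hne))
    obtain ⟨Q, hQ, rfl⟩ := hreal p₂ hp₂ (hp₂t h0)
    obtain ⟨P, hP, rfl⟩ := hreal p hp.le hpt'
    rw [hq ENNReal.ofReal_lt_top]
    rw [hinv Q hQ, hinv P hP] at hscale
    exact Φ.exists_bound_of_top hn hs (by simpa using hp) hQ hθ0 hθ1 hscale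
  · simp only [lt_top_iff_ne_top.mpr hp₁t, if_true, sub_zero]
    obtain ⟨P₁, hP₁, rfl⟩ := hreal p₁ hp₁ hp₁t
    rw [hinv P₁ hP₁] at hscale hne
    have hq₁r : 1 < P₁ → q₁ = ∞ := fun h => hq₁ (by simpa using h)
    have hq₁r' : P₁ = 1 → q₁ = 1 := fun h => hq₁' (by simpa using h)
    rcases lt_or_ge ((p₂⁻¹).toReal - s / n) 0 with h0 | h0
    · exact Φ.exists_bound_of_neg hn hp hP₁ hp₂ hθ0 hscale hq hq' hq₁r hq₁r' h0
    · have hpt' : p ≠ ∞ := hpt (by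
        rw [hscale]
        have h1 : 0 < (1 - θ) * P₁⁻¹ := mul_pos (by linarith) (by positivity)
        have h2 := mul_nonneg hθ0.le h0
        linarith)
      obtain ⟨Q, hQ, rfl⟩ := hreal p₂ hp₂ (hp₂t h0)
      obtain ⟨P, hP, rfl⟩ := hreal p hp.le hpt'
      rw [hq ENNReal.ofReal_lt_top]
      rw [hinv Q hQ] at hscale hne h0
      rw [hinv P hP] at hscale
      exact Φ.exists_bound_of_nonneg hn (by simpa using hp) hs hP₁ hQ hθ0 hθ1 hscale hne
        hq₁r hq₁r' h0
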